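/- Let $n\in\mathbb N$, $\ell\in\{1,\dots,n\}$, and let $(K_\alpha)_{\alpha\in\mathbb N_0^n}$ be a family of real constants. There is a constant $C>0$, depending only on $n$, $\ell$ and the family $(K_\alpha)$, such that the following holds. Let $\Omega\subset\mathbb R^n$ be a bounded domain that is star shaped with respect to a ball $B\subset\Omega$, i.e. for every $y\in\Omega$ the convex hull of $B\cup\{y\}$ is contained in $\Omega$. Set $R=\operatorname{diam}(\Omega)$ and $\rho=\operatorname{diam}(B)$. Let $\theta\in C^\infty(\mathbb R^n)$ be supported in $\overline B$ with $\int\theta\,dx=1$ and, for every multi-index $\alpha$, $$\|\partial^\alpha\theta\|_{L^1}\le \frac{K_\alpha}{\rho^{|\alpha|}},\qquad \|\partial^\alpha\theta\|_{L^\infty}\le \frac{K_\alpha}{\rho^{n+|\alpha|}} .$$ For $m\in\{1,\dots,n\}$ and a real-valued $f\in L^2(\mathbb R^n)$ with $\operatorname{supp} f\subset\overline\Omega$, let $$Q_\ell f(x)=\int_0^1(1-s)^{n-\ell}\int_{\mathbb R^n}\theta\Big(y+\frac{x-y}{s}\Big)\,\frac{x_m-y_m}{s}\,f(y)\,dy\,\frac{ds}{s^n}.$$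 Then for almost every $x\in\Omega$ this double integral converges absolutely, $Q_\ell f\in H^1(\Omega)$, and its $H^1$-seminorm $|u|_{H^1(\Omega)}=\big(\sum_{j=1}^n\|\partial_j u\|_{L^2(\Omega)}^2\big)^{1/2}$ satisfies $$|Q_\ell f|_{H^1(\Omega)}\le C\,\frac R\rho\,\kappa\,\|f\|_{L^2(\Omega)},$$ where $\kappa=1$ if $\ell<\frac n2+1$, and, if $\ell\ge\frac n2+1$, $$\kappa=1+\Big(\log\frac{|\Omega|}{|B|}\Big)^{\frac{n}{2(\ell-1)}}\Big(\frac{|\Omega|}{|B|}\Big)^{\frac{2(\ell-1)-n}{2(\ell-1)}} .$$ -/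

import Mathlib

open MeasureTheory Set
open scoped ContDiff

noncomputable section

/-- The partial derivative `∂_j u`. -/
def partialDeriv {n : ℕ} (j : Fin n) (u : EuclideanSpace ℝ (Fin n) → ℝ) :
    EuclideanSpace ℝ (Fin n) → ℝ :=
  fun x => fderiv ℝ u x (EuclideanSpace.single j 1)

/-- The derivative `∂^α u = ∂_1^{α_1} ⋯ ∂_n^{α_n} u` for a multi-index `α`. -/
def multiDeriv {n : ℕ} (α : Fin n → ℕ) (u : EuclideanSpace ℝ (Fin n) → ℝ) :
    EuclideanSpace ℝ (Fin n) → ℝ :=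
  (List.finRange n).foldr (fun j v => (partialDeriv j)^[α j] v) u

/-- `Ω` is a bounded domain that is star shaped with respect to the ball `B = ball c r ⊆ Ω`:
for every `y ∈ Ω` the convex hull of `B ∪ {y}` is contained in `Ω`.
(Connectedness is then automatic.) -/
structure IsBoundedDomainStarShapedBall {n : ℕ} (Ω : Set (EuclideanSpace ℝ (Fin n)))
    (c : EuclideanSpace ℝ (Fin n)) (r : ℝ) : Prop where
  isOpen : IsOpen Ω
  isBounded : Bornology.IsBounded Ω
  radius_pos : 0 < r
  ball_subset : Metric.ball c r ⊆ Ω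
  convexHull_subset : ∀ y ∈ Ω, convexHull ℝ (Metric.ball c r ∪ {y}) ⊆ Ω

/-- `θ` is a smooth function of integral one, supported on the ball with centre `c` and radius `r`,
whose derivatives satisfy `‖∂^α θ‖_{L^1} ≤ K α / diam(B)^{|α|}` and
`‖∂^α θ‖_{L^∞} ≤ K α / diam(B)^{n + |α|}`. -/
structure IsRegularizingKernel {n : ℕ} (K : (Fin n → ℕ) → ℝ)
    (c : EuclideanSpace ℝ (Fin n)) (r : ℝ) (θ : EuclideanSpace ℝ (Fin n) → ℝ) : Prop where
  contDiff : ContDiff ℝ ∞ θ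
  tsupport_subset : tsupport θ ⊆ Metric.closedBall c r
  integral_eq_one : ∫ x, θ x = 1
  integral_abs_le : ∀ α : Fin n → ℕ,
    ∫ x, |multiDeriv α θ x| ≤ K α / Metric.diam (Metric.ball c r) ^ (∑ i, α i)
  abs_le : ∀ (α : Fin n → ℕ) (x : EuclideanSpace ℝ (Fin n)),
    |multiDeriv α θ x| ≤ K α / Metric.diam (Metric.ball c r) ^ (n + ∑ i, α i)

/-- The integrand of `Q_ℓ f(x)`, as a function of `s` and `y`. -/
def bogIntegrand {n : ℕ} (ℓ : ℕ) (θ : EuclideanSpace ℝ (Fin n) → ℝ) (m : Fin n)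
    (f : EuclideanSpace ℝ (Fin n) → ℝ) (x : EuclideanSpace ℝ (Fin n))
    (s : ℝ) (y : EuclideanSpace ℝ (Fin n)) : ℝ :=
  (1 - s) ^ (n - ℓ) * (θ (y + s⁻¹ • (x - y)) * ((x m - y m) / s) * f y) / s ^ n

/-- The reduced Bogovskiĭ-type operator
`Q_ℓ f(x) = ∫_0^1 (1-s)^{n-ℓ} ∫ θ(y + (x-y)/s) ((x_m - y_m)/s) f(y) dy ds / s^n`. -/
def bogReduced {n : ℕ} (ℓ : ℕ) (θ : EuclideanSpace ℝ (Fin n) → ℝ) (m : Fin n)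
    (f : EuclideanSpace ℝ (Fin n) → ℝ) (x : EuclideanSpace ℝ (Fin n)) : ℝ :=
  ∫ s in Ioo (0 : ℝ) 1, ∫ y, bogIntegrand ℓ θ m f x s y

/-- `u ∈ H^1(Ω)`, with weak gradient `g = (g_1, …, g_n)`: `u` and all `g_j` are in `L^2(Ω)` and
`∫_Ω u ∂_j φ = - ∫_Ω g_j φ` for every `φ ∈ C_c^∞(Ω)`. -/
structure HasL2WeakGradient {n : ℕ} (Ω : Set (EuclideanSpace ℝ (Fin n)))
    (u : EuclideanSpace ℝ (Fin n) → ℝ) (g : Fin n → EuclideanSpace ℝ (Fin n) → ℝ) : Prop where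
  memLp : MemLp u 2 (volume.restrict Ω)
  memLp_grad : ∀ j, MemLp (g j) 2 (volume.restrict Ω)
  integral_eq : ∀ (j : Fin n) (φ : EuclideanSpace ℝ (Fin n) → ℝ),
    ContDiff ℝ ∞ φ → HasCompactSupport φ → tsupport φ ⊆ Ω →
      ∫ x in Ω, u x * partialDeriv j φ x = - ∫ x in Ω, g j x * φ x

/-- The factor `κ`, a function of `n`, `ℓ` and the volume ratio `t = |Ω| / |B|`. -/
def bogKappa (n ℓ : ℕ) (t : ℝ) : ℝ :=
  if (ℓ : ℝ) < (n : ℝ) / 2 + 1 then 1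
  else 1 + Real.log t ^ ((n : ℝ) / (2 * ((ℓ : ℝ) - 1))) *
    t ^ ((2 * ((ℓ : ℝ) - 1) - (n : ℝ)) / (2 * ((ℓ : ℝ) - 1)))

end

open scoped FourierTransform SchwartzMap ENNReal LineDeriv

/-! ### Fourier identities for dilated pairings, and Plancherel for integrable functions -/

section Fourier

variable {V : Type*} [NormedAddCommGroup V] [InnerProductSpace ℝ V] [FiniteDimensional ℝ V]
  [MeasurableSpace V] [BorelSpace V]

/-! The gradient is estimated by duality, testing `bogReduced` against `∂_j φ`. Substituting `x = (1
- s) y + s z` removes every negative power of `s`, and splitting `z_m - y_m = (z_m - c_m) - (y_m -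
c_m)` about the centre of the ball separates variables. What remains is the integral over `s`, with
weight `(1 - s)^(n - ℓ)`, of two pairings `∫ h(y) ∫ η(z) ∂_jφ((1 - s) y + s z) dz dy`: a bump of
mass about `ρ` with `h = f`, and `θ` itself with `h = (y_m - c_m) f`, whose norm is at most `R ‖f‖`.
Fourier inversion turns such a pairing into the integral of `𝓕⁻h((1 - s)ξ) 𝓕⁻η(sξ) 𝓕(∂_jφ)(ξ)`. With
`A` the mass of the bump, three bounds carry the proof:

For `s < 1/2`, the weight `‖ξ‖ / (1 + (ρ s ‖ξ‖)²)` has an integral in `s` of order `1/ρ`, uniformly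
in `ξ`. Cauchy–Schwarz in `(s, ξ)` then gives `A/ρ` (`lintegral_dilation_pairing_low_sq_le`).

For `s ≥ 1/2`, decay of `𝓕⁻η` absorbs `‖ξ‖`, and dilating `𝓕⁻h` costs `(1 - s)^(-n/2)`
(`lintegral_dilation_pairing_high_sq_le`). Alternatively `‖𝓕⁻h‖_∞ ≤ ‖h‖_1 ≤ |Ω|^(1/2) ‖h‖_2`, and
Plancherel for `∂_jη` gives a factor `√t` with `t = |Ω|/|B|`
(`lintegral_dilation_pairing_bdd_sq_le`).

Integrating the smaller of the last two against `σ^(n - ℓ)`, `σ = 1 - s`, yields `κ`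
(`exists_lintegral_weight_le`). The two pairings contribute `1` and `R/ρ`, and `ρ ≤ R`. Finally the
bound on test functions becomes a weak derivative in `L²` by Riesz representation
(`exists_weak_partialDeriv`), while `bogReduced` itself is in `L²` by a Schur test
(`memLp_bogReduced`). -/

theorem integral_mul_fourierInv_smul (t : ℝ) {h G : V → ℂ} (hh : Integrable h)
    (hG : Integrable G) :
    ∫ y, h y * 𝓕⁻ G (t • y) = ∫ ξ, 𝓕⁻ h (t • ξ) * G ξ := by
  -- The general transform uses the character at `-L v w`, so the form `-t⟨·,·⟩` produces the
  -- inverse transform dilated by `t`.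
  have key := VectorFourier.integral_fourierIntegral_smul_eq_flip
    (e := Real.fourierChar) (μ := (volume : Measure V)) (ν := (volume : Measure V))
    (L := (-t) • innerₗ V) (f := h) (g := G) Real.continuous_fourierChar
    (by simp only [LinearMap.smul_apply, innerₗ_apply_apply, smul_eq_mul]; fun_prop) hh hG
  have e1 : ∀ ξ, VectorFourier.fourierIntegral Real.fourierChar volume ((-t) • innerₗ V) h ξ
      = 𝓕⁻ h (t • ξ) := by
    intro ξ
    rw [Real.fourierInv_eq]
    simp [VectorFourier.fourierIntegral, inner_smul_right]
  have e2 : ∀ y, VectorFourier.fourierIntegral Real.fourierChar volume ((-t) • innerₗ V).flip G y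
      = 𝓕⁻ G (t • y) := by
    intro ξ
    rw [Real.fourierInv_eq]
    simp [VectorFourier.fourierIntegral, inner_smul_right, real_inner_comm]
  simp only [e1, e2, smul_eq_mul] at key
  exact key.symm

theorem continuous_fourierInv {h : V → ℂ} (hh : Integrable h) : Continuous (𝓕⁻ h) := by
  have : 𝓕⁻ h = fun x => 𝓕 h (-x) := by ext x; exact Real.fourierInv_eq_fourier_neg h x
  rw [this]
  exact (VectorFourier.fourierIntegral_continuous Real.continuous_fourierChar
    (by exact continuous_inner) hh).comp continuous_neg

theorem norm_fourierInv_le (h : V → ℂ) (ξ : V) : ‖𝓕⁻ h ξ‖ ≤ ∫ x, ‖h x‖ := by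
  rw [Real.fourierInv_eq]
  refine (norm_integral_le_integral_norm _).trans_eq ?_
  simp

/-- Fourier inversion writes a translate of `ψ` as the inverse transform of a modulation of `𝓕 ψ`.
Moving the transform across first in `z` and then in `y` gives the product on the right. -/
theorem integral_integral_mul_schwartz_eq (s t : ℝ) {h η : V → ℂ} (hh : Integrable h)
    (hη : Integrable η) (ψ : 𝓢(V, ℂ)) :
    ∫ y, h y * ∫ z, η z * ψ (t • y + s • z) =
      ∫ ξ, 𝓕⁻ h (t • ξ) * (𝓕⁻ η (s • ξ) * 𝓕 ψ ξ) := by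
  have hint : Integrable fun ξ => 𝓕⁻ η (s • ξ) * 𝓕 ψ ξ := by
    refine (𝓕 ψ).integrable.bdd_mul (c := ∫ x, ‖η x‖)
      (((continuous_fourierInv hη).comp (continuous_const_smul s)).aestronglyMeasurable) ?_
    exact Filter.Eventually.of_forall fun ξ => norm_fourierInv_le _ _
  rw [← integral_mul_fourierInv_smul t hh hint]
  congr 1 with y
  congr 1
  have hψ : ∀ a b : V, ψ (a + b) =
      𝓕⁻ (fun ξ => (Real.fourierChar (inner ℝ ξ a) : ℂ) * 𝓕 ψ ξ) b := by
    intro a b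
    conv_lhs => rw [← FourierTransform.fourierInv_fourier_eq (F := 𝓢(V, ℂ)) ψ]
    rw [SchwartzMap.fourierInv_coe, Real.fourierInv_eq, Real.fourierInv_eq]
    congr 1 with ξ
    rw [inner_add_right, add_comm, AddChar.map_add_eq_mul, mul_smul]
    rfl
  have hint2 : Integrable (fun ξ : V => (Real.fourierChar (inner ℝ ξ (t • y)) : ℂ) * 𝓕 ψ ξ) := by
    refine (𝓕 ψ).integrable.bdd_mul (c := 1) (Continuous.aestronglyMeasurable ?_) ?_
    · have := Real.continuous_fourierChar
      exact continuous_subtype_val.comp (this.comp (by fun_prop))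
    · exact Filter.Eventually.of_forall fun ξ => (Circle.norm_coe _).le
  simp only [hψ]
  rw [integral_mul_fourierInv_smul s hη hint2, Real.fourierInv_eq]
  congr 1 with ξ
  simp only [Circle.smul_def, smul_eq_mul]
  ring

/-- Plancherel for the transform defined by an integral. It agrees almost everywhere with the
isometric `L²` transform because both give the same result against every test function. -/
theorem eLpNorm_fourierInv_eq {h : V → ℂ} (hh : Integrable h) (h2 : MemLp h 2 volume) :
    eLpNorm (𝓕⁻ h) 2 volume = eLpNorm h 2 volume := by
  set F : Lp ℂ 2 (volume : Measure V) := h2.toLp h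
  have hae : (𝓕⁻ F : Lp ℂ 2 (volume : Measure V)) =ᵐ[volume] 𝓕⁻ h := by
    refine ae_eq_of_integral_contDiff_smul_eq
      ((Lp.memLp _).locallyIntegrable (by norm_num))
      (continuous_fourierInv hh).locallyIntegrable ?_
    intro g hg hgc
    have hg₁ : HasCompactSupport (Complex.ofRealCLM ∘ g) := hgc.comp_left rfl
    have hg₂ : ContDiff ℝ ∞ (Complex.ofRealCLM ∘ g) := by fun_prop
    set G : 𝓢(V, ℂ) := hg₁.toSchwartzMap hg₂
    have hG : ∀ x, G x = (g x : ℂ) := fun x => rfl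
    have e1 := congrArg (fun T => T G) (Lp.fourierInv_toTemperedDistribution_eq F)
    simp only [TemperedDistribution.fourierInv_apply, Lp.toTemperedDistribution_apply,
      smul_eq_mul] at e1
    have e2 := integral_mul_fourierInv_smul 1 hh G.integrable
    simp only [one_smul] at e2
    simp only [Complex.real_smul]
    calc _ = ∫ x, G x * (𝓕⁻ F : Lp ℂ 2 (volume : Measure V)) x := by simp [hG]
      _ = ∫ x, (𝓕⁻ G) x * F x := e1.symm
      _ = ∫ x, h x * 𝓕⁻ (⇑G) x := by
        refine integral_congr_ae ?_
        filter_upwards [h2.coeFn_toLp] with x hx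
        rw [hx, mul_comm, SchwartzMap.fourierInv_coe]
      _ = ∫ x, 𝓕⁻ h x * G x := e2
      _ = _ := by simp [hG, mul_comm]
  rw [← eLpNorm_congr_ae hae, ← eLpNorm_congr_ae h2.coeFn_toLp, ← Lp.enorm_def, ← Lp.enorm_def]
  have : ‖(𝓕⁻ F : Lp ℂ 2 (volume : Measure V))‖ = ‖F‖ :=
    (Lp.fourierTransformₗᵢ V ℂ).symm.norm_map F
  rw [← ofReal_norm, ← ofReal_norm, this]

theorem norm_fourier_lineDeriv (ψ : 𝓢(V, ℂ)) (v ξ : V) :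
    ‖𝓕 (∂_{v} ψ) ξ‖ = 2 * Real.pi * |inner ℝ ξ v| * ‖𝓕 ψ ξ‖ := by
  have : (inner ℝ · v).HasTemperateGrowth := ((innerSL ℝ).flip v).hasTemperateGrowth
  rw [SchwartzMap.fourier_lineDerivOp_eq]
  simp [this, abs_of_pos Real.pi_pos, mul_assoc]

theorem norm_fourierInv_lineDeriv (ψ : 𝓢(V, ℂ)) (v ξ : V) :
    ‖𝓕⁻ (∂_{v} ψ) ξ‖ = 2 * Real.pi * |inner ℝ ξ v| * ‖𝓕⁻ ψ ξ‖ := by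
  have : (inner ℝ · v).HasTemperateGrowth := ((innerSL ℝ).flip v).hasTemperateGrowth
  rw [SchwartzMap.fourierInv_lineDerivOp_eq]
  simp [this, abs_of_pos Real.pi_pos, mul_assoc]

end Fourier

/-! ### Estimates for dilated pairings on the frequency side -/

section Estimates

theorem lintegral_mul_sq_le {α : Type*} [MeasurableSpace α] {μ : Measure α} {f g : α → ℝ≥0∞}
    (hf : AEMeasurable f μ) (hg : AEMeasurable g μ) :
    (∫⁻ a, f a * g a ∂μ) ^ 2 ≤ (∫⁻ a, f a ^ 2 ∂μ) * ∫⁻ a, g a ^ 2 ∂μ := by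
  have h := ENNReal.lintegral_mul_le_Lp_mul_Lq μ Real.HolderConjugate.two_two hf hg
  simp only [Pi.mul_apply, ENNReal.rpow_two] at h
  calc _ ≤ ((∫⁻ a, f a ^ 2 ∂μ) ^ (1 / 2 : ℝ) * (∫⁻ a, g a ^ 2 ∂μ) ^ (1 / 2 : ℝ)) ^ 2 := by gcongr
    _ = _ := by
      rw [← ENNReal.mul_rpow_of_nonneg _ _ (by norm_num), ← ENNReal.rpow_natCast,
        ← ENNReal.rpow_mul]
      norm_num

theorem lintegral_weight_mul_sq_le {α : Type*} [MeasurableSpace α] {μ : Measure α}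
    {w f g : α → ℝ≥0∞} (hw : AEMeasurable w μ) (hf : AEMeasurable f μ) (hg : AEMeasurable g μ) :
    (∫⁻ a, w a * f a * g a ∂μ) ^ 2 ≤ (∫⁻ a, w a * f a ^ 2 ∂μ) * ∫⁻ a, w a * g a ^ 2 ∂μ := by
  have hs : ∀ x : ℝ≥0∞, x ^ (1 / 2 : ℝ) * x ^ (1 / 2 : ℝ) = x := fun x => by
    rw [← ENNReal.rpow_add_of_nonneg _ _ (by norm_num) (by norm_num)]; norm_num
  have h := lintegral_mul_sq_le (μ := μ) (f := fun a => w a ^ (1 / 2 : ℝ) * f a)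
    (g := fun a => w a ^ (1 / 2 : ℝ) * g a) (by fun_prop) (by fun_prop)
  simp only [mul_pow, pow_two (_ ^ (1 / 2 : ℝ)), hs] at h
  refine le_trans (le_of_eq ?_) h
  congr 2 with a
  rw [mul_mul_mul_comm, hs, mul_assoc]

theorem eLpNorm_two_sq {α F : Type*} [MeasurableSpace α] {μ : Measure α} [NormedAddCommGroup F]
    (f : α → F) : eLpNorm f 2 μ ^ 2 = ∫⁻ x, ‖f x‖ₑ ^ 2 ∂μ := by
  have := eLpNorm_nnreal_pow_eq_lintegral (μ := μ) (f := f) (p := 2) (by norm_num)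
  simpa using this

variable {V : Type*} [NormedAddCommGroup V] [InnerProductSpace ℝ V] [FiniteDimensional ℝ V]
  [MeasurableSpace V] [BorelSpace V]

theorem lintegral_comp_smul_eq (G : V → ℝ≥0∞) {s : ℝ} (hs : 0 < s) :
    ∫⁻ x, G (s • x) = ENNReal.ofReal ((s ^ Module.finrank ℝ V)⁻¹) * ∫⁻ x, G x := by
  have hm : MeasurableEmbedding (fun x : V => s • x) :=
    (Homeomorph.smulOfNeZero s hs.ne').measurableEmbedding
  have := Measure.map_addHaar_smul (volume : Measure V) hs.ne'
  calc _ = ∫⁻ x, G x ∂(Measure.map (fun x : V => s • x) volume) :=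
        (hm.lintegral_map G).symm
    _ = _ := by
      rw [this, lintegral_smul_measure, abs_of_nonneg (by positivity), smul_eq_mul]

theorem lintegral_envelope_le {a b M : ℝ} (ha : 0 ≤ a) (hb : 0 < b) (hM : 0 ≤ M) :
    ∫⁻ s in Ioi (0 : ℝ), ENNReal.ofReal (a * (M / (1 + (b * (s * a)) ^ 2))) ≤
      ENNReal.ofReal (2 * M / b) := by
  rcases ha.eq_or_lt with rfl | ha
  · simp
  have hab : 0 < b * a := by positivity
  have h1 : ∀ s : ℝ, a * (M / (1 + (b * (s * a)) ^ 2)) =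
      (fun x => a * M * (1 + x ^ 2)⁻¹) ((b * a) * s) := fun s => by
    simp only [div_eq_mul_inv]; ring_nf
  have hi : Integrable (fun x : ℝ => a * M * (1 + x ^ 2)⁻¹) := integrable_inv_one_add_sq.const_mul _
  simp only [h1]
  rw [← ofReal_integral_eq_lintegral_ofReal]
  · rw [integral_comp_mul_left_Ioi (fun x => a * M * (1 + x ^ 2)⁻¹) 0 hab, mul_zero,
      integral_const_mul, integral_Ioi_inv_one_add_sq]
    apply ENNReal.ofReal_le_ofReal
    have : Real.pi ≤ 4 := Real.pi_le_four
    rw [smul_eq_mul, Real.arctan_zero, sub_zero]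
    calc _ = (M / b) * (Real.pi / 2) := by field_simp
      _ ≤ (M / b) * 2 := by gcongr; linarith
      _ = _ := by ring
  · exact (hi.comp_mul_left' hab.ne').integrableOn
  · refine Filter.Eventually.of_forall fun s => ?_
    positivity

/-- A bound for each fixed `s` would diverge like `1/s`. Instead Cauchy–Schwarz is applied jointly
in `(s, ξ)` with the weight `w`, whose integral in `s` does not depend on `ξ`. -/
theorem lintegral_dilation_pairing_low_sq_le {P F H : V → ℝ≥0∞} (hP : Measurable P)
    (hF : Measurable F) {M ρ : ℝ} (hM : 0 ≤ M) (hρ : 0 < ρ)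
    (hH : ∀ ξ, H ξ ≤ ENNReal.ofReal (M / (1 + (ρ * ‖ξ‖) ^ 2))) :
    (∫⁻ s in Ioo (0 : ℝ) (1 / 2), ∫⁻ ξ : V, F ((1 - s) • ξ) * (H (s • ξ) * (‖ξ‖ₑ * P ξ))) ^ 2 ≤
      ENNReal.ofReal ((2 ^ (Module.finrank ℝ V + 2) * M / ρ) ^ 2) *
        ((∫⁻ ξ, P ξ ^ 2) * ∫⁻ ξ, F ξ ^ 2) := by
  set d := Module.finrank ℝ V
  set w : ℝ × V → ℝ≥0∞ := fun p =>
    ENNReal.ofReal (‖p.2‖ * (M / (1 + (ρ * (p.1 * ‖p.2‖)) ^ 2))) with hw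
  have hwm : Measurable w := by fun_prop
  set μ : Measure ℝ := volume.restrict (Ioo (0 : ℝ) (1 / 2)) with hμ
  have hwint : ∀ ξ : V, ∫⁻ s, w (s, ξ) ∂μ ≤ ENNReal.ofReal (2 * M / ρ) := fun ξ =>
    (lintegral_mono_set Ioo_subset_Ioi_self).trans
      (lintegral_envelope_le (norm_nonneg ξ) hρ hM)
  have hFm : Measurable fun p : ℝ × V => F ((1 - p.1) • p.2) := by fun_prop
  have step1 : ∫⁻ s, (∫⁻ ξ : V, F ((1 - s) • ξ) * (H (s • ξ) * (‖ξ‖ₑ * P ξ))) ∂μ ≤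
      ∫⁻ p, w p * P p.2 * F ((1 - p.1) • p.2) ∂(μ.prod volume) := by
    rw [lintegral_prod _ (by fun_prop)]
    refine setLIntegral_mono' measurableSet_Ioo fun s hs => lintegral_mono fun ξ => ?_
    have : H (s • ξ) * ‖ξ‖ₑ ≤ w (s, ξ) := by
      rw [hw]
      simp only
      rw [mul_comm ‖ξ‖, ENNReal.ofReal_mul (by positivity), ofReal_norm]
      gcongr
      refine (hH _).trans_eq ?_
      rw [norm_smul, Real.norm_of_nonneg hs.1.le]
    calc _ = H (s • ξ) * ‖ξ‖ₑ * P ξ * F ((1 - s) • ξ) := by ring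
      _ ≤ _ := by gcongr
  have step2 : ∫⁻ p, w p * P p.2 ^ 2 ∂(μ.prod volume) ≤
      ENNReal.ofReal (2 * M / ρ) * ∫⁻ ξ, P ξ ^ 2 := by
    rw [lintegral_prod_symm _ (by fun_prop), ← lintegral_const_mul _ (by fun_prop)]
    refine lintegral_mono fun ξ => ?_
    simp only
    rw [lintegral_mul_const _ (by fun_prop)]
    gcongr
    exact hwint ξ
  have step3 : ∫⁻ p, w p * F ((1 - p.1) • p.2) ^ 2 ∂(μ.prod volume) ≤
      ENNReal.ofReal (2 ^ (d + 1) * (2 * M / ρ)) * ∫⁻ ξ, F ξ ^ 2 := by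
    have inner : ∀ s ∈ Ioo (0 : ℝ) (1 / 2), ∫⁻ ξ : V, w (s, ξ) * F ((1 - s) • ξ) ^ 2 ≤
        ENNReal.ofReal (2 ^ (d + 1)) * ∫⁻ ξ : V, w (s, ξ) * F ξ ^ 2 := by
      intro s hs
      have hs1 : 0 < 1 - s := by linarith [hs.2]
      have hs2 : (1 - s)⁻¹ ≤ 2 := by
        rw [inv_le_comm₀ hs1 (by norm_num)]; linarith [hs.2]
      have hs3 : 1 ≤ (1 - s)⁻¹ := (one_le_inv₀ hs1).2 (by linarith [hs.1])
      -- Undoing the dilation of `F` costs `(1 - s)^(-d) ≤ 2^d`. Shrinking the frequency by `1 - s ≥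
      -- 1/2` in `w` loses at most a factor `2`, since only the prefactor `‖ξ‖` decreases.
      calc _ ≤ ∫⁻ ξ, (fun ζ => ENNReal.ofReal 2 * (w (s, ζ) * F ζ ^ 2)) ((1 - s) • ξ) := by
            refine lintegral_mono fun ξ => ?_
            simp only
            rw [← mul_assoc]
            gcongr
            rw [hw]
            simp only
            rw [← ENNReal.ofReal_mul (by norm_num), norm_smul, Real.norm_of_nonneg hs1.le]
            apply ENNReal.ofReal_le_ofReal
            have h1 : ‖ξ‖ ≤ 2 * ((1 - s) * ‖ξ‖) := by nlinarith [norm_nonneg ξ, hs.2]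
            rw [← mul_assoc 2]
            have := hs.1
            have h2 : (1 - s) * ‖ξ‖ ≤ ‖ξ‖ := by nlinarith [norm_nonneg ξ]
            refine mul_le_mul h1 ?_ (by positivity) (by positivity)
            gcongr
        _ = ENNReal.ofReal (((1 - s) ^ d)⁻¹) *
            (ENNReal.ofReal 2 * ∫⁻ ξ : V, w (s, ξ) * F ξ ^ 2) := by
            refine (lintegral_comp_smul_eq (fun ζ => ENNReal.ofReal 2 * (w (s, ζ) * F ζ ^ 2))
              hs1).trans ?_
            rw [lintegral_const_mul _ (by fun_prop)]
        _ ≤ _ := by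
            rw [← mul_assoc, ← ENNReal.ofReal_mul (by positivity)]
            gcongr
            rw [← inv_pow, pow_succ]
            gcongr
    rw [lintegral_prod _ (by fun_prop)]
    calc _ ≤ ∫⁻ s, ENNReal.ofReal (2 ^ (d + 1)) * (∫⁻ ξ : V, w (s, ξ) * F ξ ^ 2) ∂μ :=
          setLIntegral_mono' measurableSet_Ioo inner
      _ = ENNReal.ofReal (2 ^ (d + 1)) * ∫⁻ s, (∫⁻ ξ : V, w (s, ξ) * F ξ ^ 2) ∂μ :=
          lintegral_const_mul _ (Measurable.lintegral_prod_right'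
            (f := fun p : ℝ × V => w p * F p.2 ^ 2) (by fun_prop))
      _ = ENNReal.ofReal (2 ^ (d + 1)) * ∫⁻ ξ : V, (∫⁻ s, w (s, ξ) * F ξ ^ 2 ∂μ) := by
          rw [lintegral_lintegral_swap (by fun_prop)]
      _ ≤ ENNReal.ofReal (2 ^ (d + 1)) * ∫⁻ ξ, ENNReal.ofReal (2 * M / ρ) * F ξ ^ 2 := by
          gcongr with ξ
          rw [lintegral_mul_const _ (by fun_prop)]
          gcongr
          exact hwint ξ
      _ = _ := by
          rw [lintegral_const_mul _ (by fun_prop), ← mul_assoc,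
            ← ENNReal.ofReal_mul (by positivity)]
  calc _ ≤ (∫⁻ p, w p * P p.2 * F ((1 - p.1) • p.2) ∂(μ.prod volume)) ^ 2 := by gcongr
    _ ≤ (∫⁻ p, w p * P p.2 ^ 2 ∂(μ.prod volume)) *
        ∫⁻ p, w p * F ((1 - p.1) • p.2) ^ 2 ∂(μ.prod volume) :=
      lintegral_weight_mul_sq_le (by fun_prop) (by fun_prop) (by fun_prop)
    _ ≤ (ENNReal.ofReal (2 * M / ρ) * ∫⁻ ξ, P ξ ^ 2) *
        (ENNReal.ofReal (2 ^ (d + 1) * (2 * M / ρ)) * ∫⁻ ξ, F ξ ^ 2) := by gcongr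
    _ = ENNReal.ofReal ((2 * M / ρ) * (2 ^ (d + 1) * (2 * M / ρ))) *
        ((∫⁻ ξ, P ξ ^ 2) * ∫⁻ ξ, F ξ ^ 2) := by
      rw [ENNReal.ofReal_mul (p := 2 * M / ρ) (by positivity)]; ring
    _ ≤ _ := by
      gcongr
      have : (1 : ℝ) ≤ 2 ^ (d + 1) := one_le_pow₀ (by norm_num)
      have h2 : 0 ≤ 2 * M / ρ := by positivity
      calc _ ≤ (2 ^ (d + 1) * (2 * M / ρ)) * (2 ^ (d + 1) * (2 * M / ρ)) := by
            gcongr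
            exact le_mul_of_one_le_left h2 this
        _ = _ := by ring

theorem lintegral_dilation_pairing_high_sq_le {P F H : V → ℝ≥0∞} (hP : Measurable P)
    (hF : Measurable F) {M ρ s : ℝ} (hM : 0 ≤ M) (hρ : 0 < ρ)
    (hH : ∀ ξ, H ξ ≤ ENNReal.ofReal (M / (1 + (ρ * ‖ξ‖) ^ 2))) (hs : 1 / 2 ≤ s) (hs1 : s < 1) :
    (∫⁻ ξ : V, F ((1 - s) • ξ) * (H (s • ξ) * (‖ξ‖ₑ * P ξ))) ^ 2 ≤
      ENNReal.ofReal ((M / ρ) ^ 2 * ((1 - s) ^ Module.finrank ℝ V)⁻¹) *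
        ((∫⁻ ξ, P ξ ^ 2) * ∫⁻ ξ, F ξ ^ 2) := by
  have h1 : ∀ ξ, H (s • ξ) * ‖ξ‖ₑ ≤ ENNReal.ofReal (M / ρ) := by
    intro ξ
    rw [← ofReal_norm]
    refine (mul_le_mul_left (hH _) _).trans ?_
    rw [← ENNReal.ofReal_mul (by positivity), norm_smul, Real.norm_of_nonneg (by linarith)]
    apply ENNReal.ofReal_le_ofReal
    rw [div_mul_eq_mul_div, div_le_div_iff₀ (by positivity) hρ, mul_assoc]
    gcongr
    have : 0 ≤ ‖ξ‖ * ρ := by positivity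
    -- With `a = ρ s ‖ξ‖`, one has `1 + a² ≥ 2a ≥ ρ ‖ξ‖`, because `s ≥ 1/2`.
    nlinarith [sq_nonneg (ρ * (s * ‖ξ‖) - 1)]
  calc _ ≤ (∫⁻ ξ, ENNReal.ofReal (M / ρ) * (P ξ * F ((1 - s) • ξ))) ^ 2 := by
        refine pow_le_pow_left' (lintegral_mono fun ξ => ?_) 2
        calc _ = H (s • ξ) * ‖ξ‖ₑ * (P ξ * F ((1 - s) • ξ)) := by ring
          _ ≤ _ := by gcongr; exact h1 ξ
    _ = ENNReal.ofReal (M / ρ) ^ 2 * (∫⁻ ξ, P ξ * F ((1 - s) • ξ)) ^ 2 := by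
        rw [lintegral_const_mul _ (by fun_prop), mul_pow]
    _ ≤ ENNReal.ofReal (M / ρ) ^ 2 * ((∫⁻ ξ, P ξ ^ 2) * ∫⁻ ξ, F ((1 - s) • ξ) ^ 2) := by
        gcongr
        exact lintegral_mul_sq_le (by fun_prop) (by fun_prop)
    _ = _ := by
        rw [lintegral_comp_smul_eq (fun ξ => F ξ ^ 2) (by linarith : 0 < 1 - s),
          ENNReal.ofReal_mul (by positivity), ENNReal.ofReal_pow (by positivity)]
        ring

theorem lintegral_dilation_pairing_bdd_sq_le {P F D : V → ℝ≥0∞} (hP : Measurable P)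
    (hD : Measurable D) {N : ℝ≥0∞} {s : ℝ} (hF : ∀ ξ, F ξ ≤ N) (hs : 0 < s) :
    (∫⁻ ξ, F ((1 - s) • ξ) * (D (s • ξ) * P ξ)) ^ 2 ≤
      N ^ 2 * (ENNReal.ofReal ((s ^ Module.finrank ℝ V)⁻¹) * ∫⁻ ξ, D ξ ^ 2) *
        ∫⁻ ξ, P ξ ^ 2 := by
  calc _ ≤ (∫⁻ ξ, N * (D (s • ξ) * P ξ)) ^ 2 := by
        gcongr with ξ
        exact hF _
    _ = N ^ 2 * (∫⁻ ξ, D (s • ξ) * P ξ) ^ 2 := by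
        rw [lintegral_const_mul _ (by fun_prop), mul_pow]
    _ ≤ N ^ 2 * ((∫⁻ ξ, D (s • ξ) ^ 2) * ∫⁻ ξ, P ξ ^ 2) := by
        gcongr
        exact lintegral_mul_sq_le (by fun_prop) (by fun_prop)
    _ = _ := by
        rw [lintegral_comp_smul_eq (fun ξ => D ξ ^ 2) hs]
        ring

end Estimates

/-! ### The integral over `1 - s` and its comparison with `κ` -/

section Weight

theorem one_le_bogKappa (n ℓ : ℕ) {t : ℝ} (ht : 1 ≤ t) : 1 ≤ bogKappa n ℓ t := by
  unfold bogKappa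
  split_ifs
  · exact le_rfl
  · have := Real.log_nonneg ht
    simp only [le_add_iff_nonneg_right]
    positivity

/-- The argument naturally produces a pure power of `t`, with an exponent no larger than the one in
`κ`; this converts it. -/
theorem rpow_le_const_mul_bogKappa {n ℓ : ℕ} (hℓn : ℓ ≤ n) (h : (n : ℝ) / 2 + 1 ≤ ℓ) {t : ℝ}
    (ht : 1 ≤ t) :
    t ^ ((ℓ - 1 : ℝ) / n - 1 / 2) ≤ Real.exp 1 * bogKappa n ℓ t := by
  have h' : ¬ ((ℓ : ℝ) < (n : ℝ) / 2 + 1) := not_lt.2 h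
  have hn : (0 : ℝ) < n := by
    have : (ℓ : ℝ) ≤ n := by exact_mod_cast hℓn
    have h0 : (0 : ℝ) ≤ n := by positivity
    linarith
  have hl : (0 : ℝ) < ℓ - 1 := by linarith
  have hln : (ℓ - 1 : ℝ) ≤ n := by
    have : (ℓ : ℝ) ≤ n := by exact_mod_cast hℓn
    linarith
  have hexp : 0 ≤ (ℓ - 1 : ℝ) / n - 1 / 2 := by
    rw [sub_nonneg, le_div_iff₀ hn]; linarith
  have hk := one_le_bogKappa n ℓ ht
  have ht0 : 0 < t := by linarith
  -- For `t ≤ e` the logarithm may be small, so only the summand `1` of `κ` is used; this is the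
  -- origin of the constant `e`.
  rcases le_total t (Real.exp 1) with hte | hte
  · calc t ^ ((ℓ - 1 : ℝ) / n - 1 / 2) ≤ t ^ (1 : ℝ) := by
          apply Real.rpow_le_rpow_of_exponent_le ht
          have : (ℓ - 1 : ℝ) / n ≤ 1 := by rw [div_le_one hn]; exact hln
          linarith
      _ = t := Real.rpow_one t
      _ ≤ Real.exp 1 * 1 := by rw [mul_one]; exact hte
      _ ≤ _ := by gcongr
  · have hlog : 1 ≤ Real.log t := by rwa [Real.le_log_iff_exp_le ht0]
    have h1 : t ^ ((ℓ - 1 : ℝ) / n - 1 / 2) ≤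
        t ^ ((2 * ((ℓ : ℝ) - 1) - (n : ℝ)) / (2 * ((ℓ : ℝ) - 1))) := by
      apply Real.rpow_le_rpow_of_exponent_le ht
      rw [sub_le_iff_le_add, div_add_div _ _ (by positivity) (by norm_num),
        div_le_div_iff₀ hn (by positivity)]
      -- With `a = (ℓ - 1)/n` in `[1/2, 1]`, the claim `a - 1/2 ≤ 1 - 1/(2a)` is `(1 - a)(2a - 1) ≥
      -- 0`.
      nlinarith [mul_nonneg (sub_nonneg.2 hln) (by linarith : (0 : ℝ) ≤ 2 * (ℓ - 1) - n)]
    have h2 : 1 ≤ Real.log t ^ ((n : ℝ) / (2 * ((ℓ : ℝ) - 1))) :=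
      Real.one_le_rpow hlog (by positivity)
    have h3 : t ^ ((ℓ - 1 : ℝ) / n - 1 / 2) ≤ bogKappa n ℓ t := by
      unfold bogKappa
      rw [if_neg h']
      have h4 : 0 ≤ t ^ ((2 * ((ℓ : ℝ) - 1) - (n : ℝ)) / (2 * ((ℓ : ℝ) - 1))) := by positivity
      nlinarith
    exact h3.trans (le_mul_of_one_le_left (by linarith) (Real.one_le_exp zero_le_one))

theorem log_le_bogKappa {n ℓ : ℕ} (hn : 0 < n) (h : (n : ℝ) / 2 + 1 = ℓ) (t : ℝ) :
    Real.log t ≤ bogKappa n ℓ t := by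
  unfold bogKappa
  have hn' : (0 : ℝ) < n := by exact_mod_cast hn
  have e : 2 * ((ℓ : ℝ) - 1) = n := by linarith
  rw [if_neg (by rw [h]; exact lt_irrefl _), e, div_self hn'.ne', sub_self, zero_div]
  simp

/-- The integral over `(0, 1)` of `σ ^ (n - ℓ)` against the two competing bounds
`σ ^ (- n / 2)` and `√t` is controlled by `bogKappa n ℓ t`. -/
theorem exists_lintegral_weight_le (n ℓ : ℕ) (hℓ : 1 ≤ ℓ) (hℓn : ℓ ≤ n) :
    ∃ C : ℝ, 0 < C ∧ ∀ t : ℝ, 1 ≤ t →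
      ∫⁻ σ in Ioc (0 : ℝ) 1, ENNReal.ofReal (σ ^ (n - ℓ)) *
        min (ENNReal.ofReal (σ ^ (-(n : ℝ) / 2))) (ENNReal.ofReal (√t)) ≤
          ENNReal.ofReal (C * bogKappa n ℓ t) := by
  have hn : (0 : ℝ) < n := by exact_mod_cast (by omega : 0 < n)
  set p : ℝ := (n - ℓ : ℝ) - n / 2 with hp
  have hpow : ∀ σ : ℝ, 0 < σ → ENNReal.ofReal (σ ^ (n - ℓ)) *
      ENNReal.ofReal (σ ^ (-(n : ℝ) / 2)) = ENNReal.ofReal (σ ^ p) := by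
    intro σ hσ
    rw [← ENNReal.ofReal_mul (by positivity), ← Real.rpow_natCast, ← Real.rpow_add hσ]
    congr 2
    rw [Nat.cast_sub hℓn, hp]
    ring
  -- This is exactly the condition `p > -1`, under which `σ^p` is integrable at `0` and the bound by
  -- `√t` is not needed.
  by_cases hcase : (ℓ : ℝ) < n / 2 + 1
  · have hp1 : -1 < p := by rw [hp]; linarith
    refine ⟨1 / (p + 1), by apply one_div_pos.2; linarith, fun t ht => ?_⟩
    rw [bogKappa, if_pos hcase, mul_one]
    calc _ ≤ ∫⁻ σ in Ioc (0 : ℝ) 1, ENNReal.ofReal (σ ^ p) := by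
          refine setLIntegral_mono' measurableSet_Ioc fun σ hσ => ?_
          rw [← hpow σ hσ.1]
          gcongr
          exact min_le_left _ _
      _ = _ := by
          rw [← ofReal_integral_eq_lintegral_ofReal, ← intervalIntegral.integral_of_le zero_le_one,
            integral_rpow (Or.inl hp1)]
          · simp [Real.zero_rpow (by linarith : p + 1 ≠ 0)]
          · exact (intervalIntegrable_iff_integrableOn_Ioc_of_le zero_le_one).1
              (intervalIntegral.intervalIntegrable_rpow' hp1)
          · filter_upwards [ae_restrict_mem measurableSet_Ioc] with σ hσ
            exact Real.rpow_nonneg hσ.1.le _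
  · rw [not_lt] at hcase
    have hp1 : p ≤ -1 := by rw [hp]; linarith
    set a : ℝ := (ℓ - 1 : ℝ) / n - 1 / 2 with ha
    have hpa : p + 1 = -(n * a) := by rw [hp, ha]; field_simp; ring
    -- The crossover point: `σ^(-n/2) = √t` at `σ = t^(-1/n)`.
    set δ : ℝ → ℝ := fun t => t ^ (-(1 : ℝ) / n) with hδ
    have hδ0 : ∀ t, 1 ≤ t → 0 < δ t := fun t ht => Real.rpow_pos_of_pos (by linarith) _
    have hδ1 : ∀ t, 1 ≤ t → δ t ≤ 1 := fun t ht =>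
      Real.rpow_le_one_of_one_le_of_nonpos ht (by
        rw [neg_div]; exact neg_nonpos.2 (by positivity))
    have hδa : ∀ t, 1 ≤ t → δ t ^ (p + 1) = t ^ a := by
      intro t ht
      rw [hδ, ← Real.rpow_mul (by linarith), hpa]
      congr 1
      field_simp
    have hlow : ∀ t, 1 ≤ t → ∫⁻ σ in Ioc (0 : ℝ) (δ t), ENNReal.ofReal (σ ^ (n - ℓ)) *
        min (ENNReal.ofReal (σ ^ (-(n : ℝ) / 2))) (ENNReal.ofReal (√t)) ≤
          ENNReal.ofReal (t ^ a) := by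
      intro t ht
      have ht0 : 0 < t := by linarith
      calc _ ≤ ∫⁻ σ in Ioc (0 : ℝ) (δ t), ENNReal.ofReal (δ t ^ (n - ℓ) * √t) := by
            refine setLIntegral_mono' measurableSet_Ioc fun σ hσ => ?_
            rw [ENNReal.ofReal_mul (pow_nonneg (hδ0 t ht).le _)]
            have := hσ.1.le
            gcongr
            · exact hσ.2
            · exact min_le_right _ _
        _ = ENNReal.ofReal (δ t ^ (n - ℓ) * √t * δ t) := by
            rw [setLIntegral_const, Real.volume_Ioc, sub_zero, ← ENNReal.ofReal_mul]
            have := hδ0 t ht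
            positivity
        _ = _ := by
            congr 1
            rw [Real.sqrt_eq_rpow, mul_right_comm, ← pow_succ, ← Real.rpow_natCast, hδ,
              ← Real.rpow_mul ht0.le, ← Real.rpow_add ht0]
            congr 1
            push_cast [Nat.cast_sub hℓn]
            rw [ha]
            field_simp
            ring
    have hsplit : ∀ t, 1 ≤ t → ∫⁻ σ in Ioc (0 : ℝ) 1, ENNReal.ofReal (σ ^ (n - ℓ)) *
        min (ENNReal.ofReal (σ ^ (-(n : ℝ) / 2))) (ENNReal.ofReal (√t)) ≤
          ENNReal.ofReal (t ^ a) + ∫⁻ σ in Ioc (δ t) 1, ENNReal.ofReal (σ ^ p) := by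
      intro t ht
      rw [← Ioc_union_Ioc_eq_Ioc (hδ0 t ht).le (hδ1 t ht)]
      refine (lintegral_union_le _ _ _).trans (add_le_add (hlow t ht) ?_)
      refine setLIntegral_mono' measurableSet_Ioc fun σ hσ => ?_
      rw [← hpow σ ((hδ0 t ht).trans hσ.1)]
      gcongr
      exact min_le_left _ _
    have hnn : ∀ t, 1 ≤ t → 0 ≤ᵐ[volume.restrict (Ioc (δ t) 1)] fun σ : ℝ => σ ^ p := by
      intro t ht
      filter_upwards [ae_restrict_mem measurableSet_Ioc] with σ hσ
      exact Real.rpow_nonneg ((hδ0 t ht).trans hσ.1).le _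
    have hint : ∀ t, 1 ≤ t → IntegrableOn (fun σ : ℝ => σ ^ p) (Ioc (δ t) 1) := by
      intro t ht
      rw [← intervalIntegrable_iff_integrableOn_Ioc_of_le (hδ1 t ht)]
      refine intervalIntegral.intervalIntegrable_rpow (Or.inr ?_)
      rw [uIcc_of_le (hδ1 t ht)]
      exact fun h => absurd h.1 (not_le.2 (hδ0 t ht))
    have hk0 : ∀ t, 1 ≤ t → 0 ≤ bogKappa n ℓ t :=
      fun t ht => zero_le_one.trans (one_le_bogKappa n ℓ ht)
    -- `p = -1` is the critical index `ℓ = n/2 + 1`, where the outer integral is `(log t)/n`. Below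
    -- it, the outer integral is at most a multiple of `δ^(p+1) = t^a`.
    rcases hp1.eq_or_lt with hp1 | hp1
    · refine ⟨Real.exp 1 + 1 / n, by positivity, fun t ht => (hsplit t ht).trans ?_⟩
      have hlog : ∫ σ in Ioc (δ t) 1, σ ^ p ≤ 1 / n * bogKappa n ℓ t := by
        rw [← intervalIntegral.integral_of_le (hδ1 t ht), hp1]
        simp only [Real.rpow_neg_one]
        rw [integral_inv_of_pos (hδ0 t ht) one_pos, one_div, Real.log_inv, hδ,
          Real.log_rpow (by linarith)]
        have := log_le_bogKappa (n := n) (ℓ := ℓ) (by omega) (by rw [hp] at hp1; linarith) t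
        calc -(-1 / (n : ℝ) * Real.log t) = 1 / n * Real.log t := by ring
          _ ≤ _ := by gcongr
      rw [← ofReal_integral_eq_lintegral_ofReal (hint t ht) (hnn t ht),
        ← ENNReal.ofReal_add (Real.rpow_nonneg (by linarith) _) (integral_nonneg_of_ae (hnn t ht))]
      apply ENNReal.ofReal_le_ofReal
      rw [add_mul]
      exact add_le_add (rpow_le_const_mul_bogKappa hℓn hcase ht) hlog
    · have hq : 0 < -(p + 1) := by linarith
      refine ⟨(1 + 1 / -(p + 1)) * Real.exp 1, by positivity, fun t ht => (hsplit t ht).trans ?_⟩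
      have hpw : ∫ σ in Ioc (δ t) 1, σ ^ p ≤ 1 / -(p + 1) * t ^ a := by
        rw [← intervalIntegral.integral_of_le (hδ1 t ht), integral_rpow, hδa t ht, Real.one_rpow]
        · have : 0 ≤ t ^ a := Real.rpow_nonneg (by linarith) _
          rw [one_div, inv_mul_eq_div, div_neg, ← neg_div, div_le_div_right_of_neg (by linarith)]
          linarith
        · refine Or.inr ⟨by linarith, ?_⟩
          rw [uIcc_of_le (hδ1 t ht)]
          exact fun h => absurd h.1 (not_le.2 (hδ0 t ht))
      rw [← ofReal_integral_eq_lintegral_ofReal (hint t ht) (hnn t ht),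
        ← ENNReal.ofReal_add (Real.rpow_nonneg (by linarith) _) (integral_nonneg_of_ae (hnn t ht))]
      apply ENNReal.ofReal_le_ofReal
      calc _ ≤ t ^ a + 1 / -(p + 1) * t ^ a := by gcongr
        _ = (1 + 1 / -(p + 1)) * t ^ a := by ring
        _ ≤ (1 + 1 / -(p + 1)) * (Real.exp 1 * bogKappa n ℓ t) := by
          gcongr
          exact rpow_le_const_mul_bogKappa hℓn hcase ht
        _ = _ := by ring

end Weight

/-! ### Bumps at scale `ρ` and the decay of their Fourier transforms -/

section Amplitude

variable {n : ℕ}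

theorem contDiff_partialDeriv {u : EuclideanSpace ℝ (Fin n) → ℝ} (hu : ContDiff ℝ ∞ u)
    (j : Fin n) : ContDiff ℝ ∞ (partialDeriv j u) :=
  (hu.fderiv_right (by simp)).clm_apply contDiff_const

theorem tsupport_partialDeriv_subset (u : EuclideanSpace ℝ (Fin n) → ℝ) (j : Fin n) :
    tsupport (partialDeriv j u) ⊆ tsupport u := by
  refine closure_minimal (fun x hx => ?_) (isClosed_tsupport u)
  refine tsupport_fderiv_subset ℝ (subset_closure ?_)
  intro h
  exact hx (by simp [partialDeriv, h])

theorem hasCompactSupport_partialDeriv {u : EuclideanSpace ℝ (Fin n) → ℝ}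
    (hc : HasCompactSupport u) (j : Fin n) : HasCompactSupport (partialDeriv j u) :=
  hc.mono' (subset_closure.trans (tsupport_partialDeriv_subset u j))

/-- A real test function, viewed as a complex-valued Schwartz function. -/
noncomputable def complexSchwartz (u : EuclideanSpace ℝ (Fin n) → ℝ) (hu : ContDiff ℝ ∞ u)
    (hc : HasCompactSupport u) : 𝓢(EuclideanSpace ℝ (Fin n), ℂ) :=
  HasCompactSupport.toSchwartzMap (f := Complex.ofRealCLM ∘ u) (hc.comp_left rfl) (by fun_prop)

theorem complexSchwartz_apply (u : EuclideanSpace ℝ (Fin n) → ℝ) (hu : ContDiff ℝ ∞ u)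
    (hc : HasCompactSupport u) (x : EuclideanSpace ℝ (Fin n)) :
    complexSchwartz u hu hc x = (u x : ℂ) := rfl

theorem lineDeriv_complexSchwartz (u : EuclideanSpace ℝ (Fin n) → ℝ) (hu : ContDiff ℝ ∞ u)
    (hc : HasCompactSupport u) (j : Fin n) :
    ∂_{EuclideanSpace.single j (1 : ℝ)} (complexSchwartz u hu hc) =
      complexSchwartz (partialDeriv j u) (contDiff_partialDeriv hu j)
        (hasCompactSupport_partialDeriv hc j) := by
  ext x
  rw [SchwartzMap.lineDerivOp_apply_eq_fderiv, complexSchwartz_apply]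
  have h1 : HasFDerivAt u (fderiv ℝ u x) x :=
    ((hu.differentiable (by simp)) x).hasFDerivAt
  have h2 : HasFDerivAt (complexSchwartz u hu hc) (Complex.ofRealCLM.comp (fderiv ℝ u x)) x :=
    Complex.ofRealCLM.hasFDerivAt.comp x h1
  rw [h2.fderiv]
  rfl

/-- A test function `η` whose derivatives obey the bounds of a bump of mass `A` at scale `ρ`. -/
structure IsBump (A ρ : ℝ) (η : EuclideanSpace ℝ (Fin n) → ℝ) : Prop where
  contDiff : ContDiff ℝ ∞ η
  hasCompactSupport : HasCompactSupport η
  integral_le : ∫ x, |η x| ≤ A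
  integral_deriv_le : ∀ j, ∫ x, |partialDeriv j η x| ≤ A / ρ
  integral_deriv_deriv_le : ∀ j, ∫ x, |partialDeriv j (partialDeriv j η) x| ≤ A / ρ ^ 2
  abs_deriv_le : ∀ j x, |partialDeriv j η x| ≤ A / ρ ^ (n + 1)

namespace IsBump

variable {A ρ : ℝ} {η : EuclideanSpace ℝ (Fin n) → ℝ}

theorem nonneg (h : IsBump A ρ η) : 0 ≤ A :=
  (integral_nonneg fun _ => abs_nonneg _).trans h.integral_le

/-- The complexification of a bump. -/
noncomputable def toSchwartz (h : IsBump A ρ η) : 𝓢(EuclideanSpace ℝ (Fin n), ℂ) :=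
  complexSchwartz η h.contDiff h.hasCompactSupport

/-- The `L¹` norm of `η` bounds the transform by `A`, and that of `∂_j²η` bounds it times `(ρ ξ_j)²`
by `A`. Summing these `n + 1` bounds gives the envelope. -/
theorem norm_fourierInv_le_envelope (h : IsBump A ρ η) (hρ : 0 < ρ)
    (ξ : EuclideanSpace ℝ (Fin n)) :
    ‖𝓕⁻ h.toSchwartz ξ‖ ≤ (n + 1) * A / (1 + (ρ * ‖ξ‖) ^ 2) := by
  have h0 : ‖𝓕⁻ h.toSchwartz ξ‖ ≤ A := by
    rw [SchwartzMap.fourierInv_coe]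
    refine (norm_fourierInv_le _ _).trans (le_trans (le_of_eq ?_) h.integral_le)
    simp [toSchwartz, complexSchwartz_apply]
  have hj : ∀ j, ρ ^ 2 * (ξ j ^ 2 * ‖𝓕⁻ h.toSchwartz ξ‖) ≤ A := by
    intro j
    set v := EuclideanSpace.single j (1 : ℝ)
    have e : ‖𝓕⁻ (∂_{v} (∂_{v} h.toSchwartz)) ξ‖ ≤ A / ρ ^ 2 := by
      rw [SchwartzMap.fourierInv_coe]
      refine (norm_fourierInv_le _ _).trans (le_trans (le_of_eq ?_) (h.integral_deriv_deriv_le j))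
      simp only [toSchwartz, v, lineDeriv_complexSchwartz, complexSchwartz_apply]
      simp
    rw [norm_fourierInv_lineDeriv, norm_fourierInv_lineDeriv] at e
    have hv : inner ℝ ξ v = ξ j := by simp [v, EuclideanSpace.inner_single_right]
    rw [hv, le_div_iff₀ (by positivity)] at e
    have hpi : 1 ≤ (2 * Real.pi) * (2 * Real.pi) := by nlinarith [Real.pi_gt_three]
    calc ρ ^ 2 * (ξ j ^ 2 * ‖𝓕⁻ h.toSchwartz ξ‖)
        ≤ (2 * Real.pi * (2 * Real.pi)) * (ρ ^ 2 * (ξ j ^ 2 * ‖𝓕⁻ h.toSchwartz ξ‖)) :=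
          le_mul_of_one_le_left (by positivity) hpi
      _ = _ := by rw [← sq_abs (ξ j)]; ring
      _ ≤ A := e
  rw [le_div_iff₀ (by positivity)]
  calc ‖𝓕⁻ h.toSchwartz ξ‖ * (1 + (ρ * ‖ξ‖) ^ 2)
      = ‖𝓕⁻ h.toSchwartz ξ‖ + ∑ j, ρ ^ 2 * (ξ j ^ 2 * ‖𝓕⁻ h.toSchwartz ξ‖) := by
        rw [mul_pow, EuclideanSpace.norm_sq_eq, ← Finset.mul_sum, ← Finset.sum_mul]
        simp only [Real.norm_eq_abs, sq_abs]
        ring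
    _ ≤ A + ∑ _j : Fin n, A := by gcongr with j; exact hj j
    _ = _ := by simp; ring

/-- Plancherel, then `‖∂_jη‖_2² ≤ ‖∂_jη‖_∞ ‖∂_jη‖_1`. -/
theorem lintegral_fourierInv_lineDeriv_sq_le (h : IsBump A ρ η) (hρ : 0 < ρ) (j : Fin n) :
    ∫⁻ ξ, ‖𝓕⁻ (∂_{EuclideanSpace.single j (1 : ℝ)} h.toSchwartz) ξ‖ₑ ^ 2 ≤
      ENNReal.ofReal (A ^ 2 / ρ ^ (n + 2)) := by
  set D := ∂_{EuclideanSpace.single j (1 : ℝ)} h.toSchwartz with hD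
  have hA := h.nonneg
  have hDx : ∀ x, D x = (partialDeriv j η x : ℂ) := fun x => by
    rw [hD, toSchwartz, lineDeriv_complexSchwartz, complexSchwartz_apply]
  rw [← eLpNorm_two_sq, SchwartzMap.fourierInv_coe, eLpNorm_fourierInv_eq D.integrable (D.memLp 2),
    eLpNorm_two_sq]
  have hint : Integrable (partialDeriv j η) :=
    (contDiff_partialDeriv h.contDiff j).continuous.integrable_of_hasCompactSupport
      (hasCompactSupport_partialDeriv h.hasCompactSupport j)
  calc _ ≤ ∫⁻ x, ENNReal.ofReal (A / ρ ^ (n + 1)) * ENNReal.ofReal |partialDeriv j η x| := by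
        refine lintegral_mono fun x => ?_
        rw [hDx, ← ofReal_norm, Complex.norm_real, Real.norm_eq_abs, pow_two]
        gcongr
        exact h.abs_deriv_le j x
    _ = ENNReal.ofReal (A / ρ ^ (n + 1) * ∫ x, |partialDeriv j η x|) := by
        rw [lintegral_const_mul' _ _ ENNReal.ofReal_ne_top, ENNReal.ofReal_mul (by positivity),
          ofReal_integral_eq_lintegral_ofReal hint.abs
            (Filter.Eventually.of_forall fun x => abs_nonneg _)]
    _ ≤ ENNReal.ofReal (A / ρ ^ (n + 1) * (A / ρ)) := by
        gcongr
        exact h.integral_deriv_le j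
    _ = _ := by
        congr 1
        field_simp
        ring

end IsBump

theorem le_ofReal_mul_of_sq_le {X Y : ℝ≥0∞} {a : ℝ} (ha : 0 ≤ a)
    (h : X ^ 2 ≤ ENNReal.ofReal (a ^ 2) * Y ^ 2) : X ≤ ENNReal.ofReal a * Y := by
  rw [ENNReal.ofReal_pow ha, ← mul_pow] at h
  exact (ENNReal.pow_le_pow_left_iff two_ne_zero).1 h

/-- The Fourier side of the bilinear form `∫ h(y) ∫ η(z) ψ((1 - s) y + s z) dz dy`, with absolute
values inside the integral. -/
noncomputable def fourierSlice (η : EuclideanSpace ℝ (Fin n) → ℂ)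
    (h : EuclideanSpace ℝ (Fin n) → ℂ) (ψ : 𝓢(EuclideanSpace ℝ (Fin n), ℂ)) (s : ℝ) : ℝ≥0∞ :=
  ∫⁻ ξ, ‖𝓕⁻ h ((1 - s) • ξ)‖ₑ * (‖𝓕⁻ η (s • ξ)‖ₑ * ‖𝓕 ψ ξ‖ₑ)

end Amplitude

/-! ### Bounds for the Fourier slices of a bump -/

section Pairing

variable {n : ℕ} {A ρ : ℝ} {η : EuclideanSpace ℝ (Fin n) → ℝ}
  {h : EuclideanSpace ℝ (Fin n) → ℂ} {s : ℝ}

theorem measurable_fourierSlice {η : EuclideanSpace ℝ (Fin n) → ℂ} (hη : Integrable η)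
    (hh : Integrable h) (ψ : 𝓢(EuclideanSpace ℝ (Fin n), ℂ)) :
    Measurable (fourierSlice η h ψ) := by
  have h1 := continuous_fourierInv hη
  have h2 := continuous_fourierInv hh
  have h3 := (𝓕 ψ).continuous
  have h4 : Measurable fun p : ℝ × EuclideanSpace ℝ (Fin n) => 𝓕⁻ h ((1 - p.1) • p.2) :=
    h2.measurable.comp (by fun_prop)
  have h5 : Measurable fun p : ℝ × EuclideanSpace ℝ (Fin n) => 𝓕⁻ η (p.1 • p.2) :=
    h1.measurable.comp (by fun_prop)
  exact Measurable.lintegral_prod_right' (f := fun p : ℝ × EuclideanSpace ℝ (Fin n) =>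
    ‖𝓕⁻ h ((1 - p.1) • p.2)‖ₑ * (‖𝓕⁻ η (p.1 • p.2)‖ₑ * ‖𝓕 ψ p.2‖ₑ)) (by fun_prop)

theorem enorm_fourier_lineDeriv_single_le (φ : 𝓢(EuclideanSpace ℝ (Fin n), ℂ)) (j : Fin n)
    (ξ : EuclideanSpace ℝ (Fin n)) :
    ‖𝓕 (∂_{EuclideanSpace.single j (1 : ℝ)} φ) ξ‖ₑ ≤
      ‖ξ‖ₑ * (ENNReal.ofReal (2 * Real.pi) * ‖𝓕 φ ξ‖ₑ) := by
  simp only [← ofReal_norm]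
  rw [norm_fourier_lineDeriv, ← ENNReal.ofReal_mul (by positivity),
    ← ENNReal.ofReal_mul (by positivity)]
  apply ENNReal.ofReal_le_ofReal
  have : |inner ℝ ξ (EuclideanSpace.single j (1 : ℝ))| ≤ ‖ξ‖ := by
    simpa using abs_real_inner_le_norm ξ (EuclideanSpace.single j (1 : ℝ))
  calc _ ≤ 2 * Real.pi * ‖ξ‖ * ‖𝓕 φ ξ‖ := by gcongr
    _ = _ := by ring

theorem lintegral_const_mul_enorm_fourier_sq (φ : 𝓢(EuclideanSpace ℝ (Fin n), ℂ)) {a : ℝ}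
    (ha : 0 ≤ a) :
    ∫⁻ ξ, (ENNReal.ofReal a * ‖𝓕 φ ξ‖ₑ) ^ 2 =
      ENNReal.ofReal (a ^ 2) * eLpNorm φ 2 volume ^ 2 := by
  have hφ := (𝓕 φ).continuous
  have e : eLpNorm φ 2 volume = eLpNorm (𝓕 φ : 𝓢(EuclideanSpace ℝ (Fin n), ℂ)) 2 volume := by
    have := eLpNorm_fourierInv_eq (𝓕 φ).integrable ((𝓕 φ).memLp 2)
    rw [← this, ← SchwartzMap.fourierInv_coe,
      FourierTransform.fourierInv_fourier_eq (F := 𝓢(EuclideanSpace ℝ (Fin n), ℂ))]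
  simp only [mul_pow]
  rw [lintegral_const_mul _ (by fun_prop), e, eLpNorm_two_sq, ENNReal.ofReal_pow ha]

theorem IsBump.lintegral_fourierSlice_low_le (hb : IsBump A ρ η) (hρ : 0 < ρ)
    (hh : Integrable h) (h2 : MemLp h 2 volume) (φ : 𝓢(EuclideanSpace ℝ (Fin n), ℂ))
    (j : Fin n) :
    ∫⁻ s in Ioo (0 : ℝ) (1 / 2), fourierSlice hb.toSchwartz h
        (∂_{EuclideanSpace.single j (1 : ℝ)} φ) s ≤
      ENNReal.ofReal (2 ^ (n + 2) * (n + 1) * (2 * Real.pi) * (A / ρ)) *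
        (eLpNorm h 2 volume * eLpNorm φ 2 volume) := by
  have hA := hb.nonneg
  have hφ := (𝓕 φ).continuous
  have hη := (𝓕⁻ hb.toSchwartz).continuous
  have hF := continuous_fourierInv hh
  refine le_ofReal_mul_of_sq_le (by positivity) ?_
  have key := lintegral_dilation_pairing_low_sq_le (V := EuclideanSpace ℝ (Fin n))
    (P := fun ξ => ENNReal.ofReal (2 * Real.pi) * ‖𝓕 φ ξ‖ₑ) (F := fun ξ => ‖𝓕⁻ h ξ‖ₑ)
    (H := fun ξ => ‖𝓕⁻ hb.toSchwartz ξ‖ₑ) (by fun_prop) (by fun_prop)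
    (M := (n + 1) * A) (by positivity) hρ
    (fun ξ => by
      rw [← ofReal_norm]
      exact ENNReal.ofReal_le_ofReal (hb.norm_fourierInv_le_envelope hρ ξ))
  rw [lintegral_const_mul_enorm_fourier_sq φ (by positivity), ← eLpNorm_two_sq,
    eLpNorm_fourierInv_eq hh h2, finrank_euclideanSpace_fin] at key
  refine le_trans ?_ (key.trans_eq ?_)
  · refine pow_le_pow_left' (lintegral_mono fun s => lintegral_mono fun ξ => ?_) 2
    rw [← SchwartzMap.fourierInv_coe]
    gcongr
    exact enorm_fourier_lineDeriv_single_le φ j ξ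
  · rw [← mul_assoc, ← mul_assoc, ← ENNReal.ofReal_mul (by positivity)]
    rw [mul_pow (eLpNorm h 2 volume), mul_right_comm, mul_assoc]
    congr 2
    ring

theorem IsBump.fourierSlice_high_le (hb : IsBump A ρ η) (hρ : 0 < ρ)
    (hh : Integrable h) (h2 : MemLp h 2 volume) (φ : 𝓢(EuclideanSpace ℝ (Fin n), ℂ))
    (j : Fin n) (hs : 1 / 2 ≤ s) (hs1 : s < 1) :
    fourierSlice hb.toSchwartz h (∂_{EuclideanSpace.single j (1 : ℝ)} φ) s ≤
      ENNReal.ofReal ((n + 1) * (2 * Real.pi) * (A / ρ) * (1 - s) ^ (-(n : ℝ) / 2)) *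
        (eLpNorm h 2 volume * eLpNorm φ 2 volume) := by
  have hA := hb.nonneg
  have hφ := (𝓕 φ).continuous
  have hη := (𝓕⁻ hb.toSchwartz).continuous
  have hF := continuous_fourierInv hh
  have hs0 : 0 < 1 - s := by linarith
  refine le_ofReal_mul_of_sq_le (by positivity) ?_
  have key := lintegral_dilation_pairing_high_sq_le (V := EuclideanSpace ℝ (Fin n))
    (P := fun ξ => ENNReal.ofReal (2 * Real.pi) * ‖𝓕 φ ξ‖ₑ) (F := fun ξ => ‖𝓕⁻ h ξ‖ₑ)
    (H := fun ξ => ‖𝓕⁻ hb.toSchwartz ξ‖ₑ) (by fun_prop) (by fun_prop)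
    (M := (n + 1) * A) (by positivity) hρ
    (fun ξ => by
      rw [← ofReal_norm]
      exact ENNReal.ofReal_le_ofReal (hb.norm_fourierInv_le_envelope hρ ξ)) hs hs1
  rw [lintegral_const_mul_enorm_fourier_sq φ (by positivity), ← eLpNorm_two_sq,
    eLpNorm_fourierInv_eq hh h2, finrank_euclideanSpace_fin] at key
  have hpow : ((1 - s) ^ (-(n : ℝ) / 2)) ^ 2 = ((1 - s) ^ n)⁻¹ := by
    rw [← Real.rpow_natCast, ← Real.rpow_mul hs0.le, ← Real.rpow_natCast, ← Real.rpow_neg hs0.le]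
    congr 1
    push_cast
    ring
  refine le_trans ?_ (key.trans_eq ?_)
  · refine pow_le_pow_left' (lintegral_mono fun ξ => ?_) 2
    rw [← SchwartzMap.fourierInv_coe]
    gcongr
    exact enorm_fourier_lineDeriv_single_le φ j ξ
  · rw [← mul_assoc, ← mul_assoc, ← ENNReal.ofReal_mul (by positivity)]
    rw [mul_pow (eLpNorm h 2 volume), mul_right_comm, mul_assoc, mul_pow _ ((1 - s) ^ _), hpow]
    congr 2
    ring

/-- The frequency factor is moved from `φ` to the bump: `|ξ_j| = s⁻¹ |(sξ)_j|` with `s⁻¹ ≤ 2`. In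
the application `b ρ^n = |B|`, so `hN` is Cauchy–Schwarz on `Ω`; its `ρ^n` cancels against the `L²`
bound for `∂_jη`. -/
theorem IsBump.fourierSlice_bdd_le (hb : IsBump A ρ η) (hρ : 0 < ρ) {b t : ℝ} (hb0 : 0 ≤ b)
    (ht : 0 ≤ t) (hN : (∫⁻ x, ‖h x‖ₑ) ^ 2 ≤
      ENNReal.ofReal (t * (b * ρ ^ n)) * eLpNorm h 2 volume ^ 2)
    (φ : 𝓢(EuclideanSpace ℝ (Fin n), ℂ)) (j : Fin n) (hs : 1 / 2 ≤ s) :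
    fourierSlice hb.toSchwartz h (∂_{EuclideanSpace.single j (1 : ℝ)} φ) s ≤
      ENNReal.ofReal (√(2 ^ (n + 2) * b) * (A / ρ) * √t) *
        (eLpNorm h 2 volume * eLpNorm φ 2 volume) := by
  have hA := hb.nonneg
  have hφ := (𝓕 φ).continuous
  have hs0 : 0 < s := by linarith
  set v := EuclideanSpace.single j (1 : ℝ)
  have hη := (𝓕⁻ (∂_{v} hb.toSchwartz)).continuous
  have hsinv : s⁻¹ ≤ 2 := by rw [inv_le_comm₀ hs0 (by norm_num)]; linarith
  refine le_ofReal_mul_of_sq_le (by positivity) ?_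
  have key := lintegral_dilation_pairing_bdd_sq_le (V := EuclideanSpace ℝ (Fin n))
    (P := fun ξ => ENNReal.ofReal 2 * ‖𝓕 φ ξ‖ₑ) (F := fun ξ => ‖𝓕⁻ h ξ‖ₑ)
    (D := fun ξ => ‖𝓕⁻ (∂_{v} hb.toSchwartz) ξ‖ₑ) (by fun_prop) (by fun_prop)
    (N := ∫⁻ x, ‖h x‖ₑ) (fun ξ => by
      rw [Real.fourierInv_eq]
      refine (enorm_integral_le_lintegral_enorm _).trans_eq ?_
      simp [← ofReal_norm]) hs0
  rw [lintegral_const_mul_enorm_fourier_sq φ (by positivity), finrank_euclideanSpace_fin] at key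
  refine le_trans ?_ (key.trans ?_)
  · refine pow_le_pow_left' (lintegral_mono fun ξ => ?_) 2
    rw [← SchwartzMap.fourierInv_coe]
    refine mul_le_mul_right ?_ _
    simp only [← ofReal_norm]
    rw [norm_fourier_lineDeriv, norm_fourierInv_lineDeriv, ← ENNReal.ofReal_mul (by positivity),
      ← ENNReal.ofReal_mul (by positivity), ← ENNReal.ofReal_mul (by positivity)]
    apply ENNReal.ofReal_le_ofReal
    rw [real_inner_smul_left, abs_mul, abs_of_pos hs0]
    have h2s : 1 ≤ 2 * s := by linarith
    calc _ ≤ (2 * s) * (‖𝓕⁻ hb.toSchwartz (s • ξ)‖ *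
          (2 * Real.pi * |inner ℝ ξ v| * ‖𝓕 φ ξ‖)) :=
          le_mul_of_one_le_left (by positivity) h2s
      _ = _ := by ring
  · calc _ ≤ ENNReal.ofReal (t * (b * ρ ^ n)) * eLpNorm h 2 volume ^ 2 *
          (ENNReal.ofReal (2 ^ n) * ENNReal.ofReal (A ^ 2 / ρ ^ (n + 2))) *
          (ENNReal.ofReal (2 ^ 2) * eLpNorm φ 2 volume ^ 2) := by
          gcongr
          · rw [← inv_pow]; gcongr
          · exact hb.lintegral_fourierInv_lineDeriv_sq_le hρ j
      _ = ENNReal.ofReal (t * (b * ρ ^ n) * (2 ^ n * (A ^ 2 / ρ ^ (n + 2))) * 2 ^ 2) *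
          (eLpNorm h 2 volume * eLpNorm φ 2 volume) ^ 2 := by
          rw [ENNReal.ofReal_mul (q := 2 ^ 2) (by positivity),
            ENNReal.ofReal_mul (p := t * (b * ρ ^ n)) (by positivity),
            ENNReal.ofReal_mul (p := 2 ^ n) (by positivity)]
          ring
      _ = _ := by
          congr 2
          rw [mul_pow, mul_pow, Real.sq_sqrt (by positivity), Real.sq_sqrt ht]
          field_simp
          ring

/-- The weighted integral of the Fourier slices of a bump is bounded by `A / ρ` times
`bogKappa`. -/
theorem exists_lintegral_fourierSlice_le (n ℓ : ℕ) (hℓ : 1 ≤ ℓ) (hℓn : ℓ ≤ n) {b : ℝ}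
    (hb0 : 0 ≤ b) : ∃ C : ℝ, 0 < C ∧
    ∀ (A ρ t : ℝ) (η : EuclideanSpace ℝ (Fin n) → ℝ) (hb : IsBump A ρ η)
      (h : EuclideanSpace ℝ (Fin n) → ℂ) (φ : 𝓢(EuclideanSpace ℝ (Fin n), ℂ)) (j : Fin n),
      0 < ρ → 1 ≤ t → Integrable h → MemLp h 2 volume →
      (∫⁻ x, ‖h x‖ₑ) ^ 2 ≤ ENNReal.ofReal (t * (b * ρ ^ n)) * eLpNorm h 2 volume ^ 2 →
      ∫⁻ s in Ioo (0 : ℝ) 1, ENNReal.ofReal ((1 - s) ^ (n - ℓ)) *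
          fourierSlice hb.toSchwartz h (∂_{EuclideanSpace.single j (1 : ℝ)} φ) s ≤
        ENNReal.ofReal (C * (A / ρ) * bogKappa n ℓ t) *
          (eLpNorm h 2 volume * eLpNorm φ 2 volume) := by
  obtain ⟨Cw, hCw, hw⟩ := exists_lintegral_weight_le n ℓ hℓ hℓn
  set C1 : ℝ := 2 ^ (n + 2) * (n + 1) * (2 * Real.pi)
  set C2 : ℝ := (n + 1) * (2 * Real.pi) + √(2 ^ (n + 2) * b)
  refine ⟨C1 + C2 * Cw, by positivity, ?_⟩
  intro A ρ t η hb h φ j hρ ht hh h2 hN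
  have hA := hb.nonneg
  have hκ := one_le_bogKappa n ℓ ht
  set Y := eLpNorm h 2 volume * eLpNorm φ 2 volume
  set S := fourierSlice hb.toSchwartz h (∂_{EuclideanSpace.single j (1 : ℝ)} φ)
  have hlow : ∫⁻ s in Ioo (0 : ℝ) (1 / 2), ENNReal.ofReal ((1 - s) ^ (n - ℓ)) * S s ≤
      ENNReal.ofReal (C1 * (A / ρ) * bogKappa n ℓ t) * Y := by
    calc _ ≤ ∫⁻ s in Ioo (0 : ℝ) (1 / 2), S s := by
          refine setLIntegral_mono' measurableSet_Ioo fun s hs => ?_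
          refine mul_le_of_le_one_left' ?_
          rw [ENNReal.ofReal_le_one]
          exact pow_le_one₀ (by linarith [hs.2]) (by linarith [hs.1])
      _ ≤ ENNReal.ofReal (C1 * (A / ρ)) * Y := hb.lintegral_fourierSlice_low_le hρ hh h2 φ j
      _ ≤ _ := by
          refine mul_le_mul_left (ENNReal.ofReal_le_ofReal ?_) _
          exact le_mul_of_one_le_right (by positivity) hκ
  -- Both bounds hold for every such `s`. `C2` is the sum of their constants, so that one factor
  -- serves the minimum.
  have hslice : ∀ s ∈ Ico (1 / 2 : ℝ) 1, S s ≤ ENNReal.ofReal (C2 * (A / ρ)) * Y *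
      min (ENNReal.ofReal ((1 - s) ^ (-(n : ℝ) / 2))) (ENNReal.ofReal (√t)) := by
    intro s hs
    rw [mul_right_comm, mul_min, min_mul]
    rw [← ENNReal.ofReal_mul (by positivity), ← ENNReal.ofReal_mul (by positivity)]
    have hs1 : 0 < 1 - s := by linarith [hs.2]
    refine le_min ((hb.fourierSlice_high_le hρ hh h2 φ j hs.1 hs.2).trans ?_)
      ((hb.fourierSlice_bdd_le hρ hb0 (by linarith) hN φ j hs.1).trans ?_)
    · gcongr
      exact le_add_of_nonneg_right (by positivity)
    · gcongr
      exact le_add_of_nonneg_left (by positivity)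
  have hhigh : ∫⁻ s in Ico (1 / 2 : ℝ) 1, ENNReal.ofReal ((1 - s) ^ (n - ℓ)) * S s ≤
      ENNReal.ofReal (C2 * Cw * (A / ρ) * bogKappa n ℓ t) * Y := by
    set g : ℝ → ℝ≥0∞ := fun σ => ENNReal.ofReal (σ ^ (n - ℓ)) *
        min (ENNReal.ofReal (σ ^ (-(n : ℝ) / 2))) (ENNReal.ofReal (√t)) with hg
    have hgm : Measurable g := by fun_prop
    calc _ ≤ ∫⁻ s in Ico (1 / 2 : ℝ) 1, ENNReal.ofReal (C2 * (A / ρ)) * Y * g (1 - s) := by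
          refine setLIntegral_mono' measurableSet_Ico fun s hs => ?_
          refine (mul_le_mul_right (hslice s hs) _).trans_eq ?_
          rw [hg]
          exact mul_left_comm _ _ _
      _ = ENNReal.ofReal (C2 * (A / ρ)) * Y * ∫⁻ s in Ico (1 / 2 : ℝ) 1, g (1 - s) :=
          lintegral_const_mul _ (by fun_prop)
      _ ≤ ENNReal.ofReal (C2 * (A / ρ)) * Y * ∫⁻ σ in Ioc (0 : ℝ) 1, g σ := by
          refine mul_le_mul_right ?_ _
          have hmp := (Measure.measurePreserving_sub_left (volume : Measure ℝ) 1)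
          rw [← hmp.setLIntegral_comp_preimage measurableSet_Ioc hgm]
          refine lintegral_mono_set fun s hs => ?_
          exact ⟨by linarith [hs.2], by linarith [hs.1]⟩
      _ ≤ ENNReal.ofReal (C2 * (A / ρ)) * Y * ENNReal.ofReal (Cw * bogKappa n ℓ t) := by
          gcongr
          exact hw t ht
      _ = _ := by
          rw [mul_right_comm, ← ENNReal.ofReal_mul (by positivity)]
          congr 2
          ring
  rw [← Ioo_union_Ico_eq_Ioo (b := (1 / 2 : ℝ)) (by norm_num) (by norm_num)]
  refine (lintegral_union_le _ _ _).trans ((add_le_add hlow hhigh).trans_eq ?_)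
  rw [← add_mul, ← ENNReal.ofReal_add (by positivity) (by positivity)]
  congr 2
  ring

end Pairing

/-! ### Absolute convergence and square integrability of `Q_ℓ f` -/

section Kernel

variable {n ℓ : ℕ} {θ : EuclideanSpace ℝ (Fin n) → ℝ} {m : Fin n}
  {f : EuclideanSpace ℝ (Fin n) → ℝ} {Ω : Set (EuclideanSpace ℝ (Fin n))} {R : ℝ}

theorem lintegral_eq_lintegral_convex_comb (G : EuclideanSpace ℝ (Fin n) → ℝ≥0∞)
    (y : EuclideanSpace ℝ (Fin n)) {s : ℝ} (hs : 0 < s) :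
    ∫⁻ x, G x = ENNReal.ofReal (s ^ n) * ∫⁻ z, G ((1 - s) • y + s • z) := by
  rw [lintegral_comp_smul_eq (fun z => G ((1 - s) • y + z)) hs, finrank_euclideanSpace_fin,
    lintegral_add_left_eq_self (μ := volume) G, ← mul_assoc, ← ENNReal.ofReal_mul (by positivity),
    mul_inv_cancel₀ (by positivity), ENNReal.ofReal_one, one_mul]

theorem integral_eq_integral_convex_comb (G : EuclideanSpace ℝ (Fin n) → ℝ)
    (y : EuclideanSpace ℝ (Fin n)) {s : ℝ} (hs : 0 < s) :
    ∫ x, G x = s ^ n * ∫ z, G ((1 - s) • y + s • z) := by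
  rw [Measure.integral_comp_smul volume (fun z => G ((1 - s) • y + z)) s,
    finrank_euclideanSpace_fin, integral_add_left_eq_self (μ := volume) G,
    abs_of_pos (by positivity), smul_eq_mul, ← mul_assoc, mul_inv_cancel₀ (by positivity), one_mul]

/-- In the variable `z` the kernel no longer depends on `s`, and the surviving `s^n` is cancelled by
the Jacobian of `z ↦ x`. -/
theorem bogIntegrand_convex_comb {s : ℝ} (hs : 0 < s) (y z : EuclideanSpace ℝ (Fin n)) :
    bogIntegrand ℓ θ m f ((1 - s) • y + s • z) s y =
      (1 - s) ^ (n - ℓ) * (θ z * (z m - y m) * f y) / s ^ n := by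
  have h1 : y + s⁻¹ • ((1 - s) • y + s • z - y) = z := by
    have : (1 - s) • y + s • z - y = s • (z - y) := by module
    rw [this, smul_smul, inv_mul_cancel₀ hs.ne', one_smul, add_sub_cancel]
  have h2 : (((1 - s) • y + s • z) m - y m) / s = z m - y m := by
    simp only [PiLp.add_apply, PiLp.smul_apply, smul_eq_mul]
    field_simp
    ring
  rw [bogIntegrand, h1, h2]

theorem aestronglyMeasurable_bogIntegrand (hθ : Continuous θ)
    (hf : AEStronglyMeasurable f volume) :
    AEStronglyMeasurable (fun q : EuclideanSpace ℝ (Fin n) × (ℝ × EuclideanSpace ℝ (Fin n)) =>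
      bogIntegrand ℓ θ m f q.1 q.2.1 q.2.2)
      (volume.prod ((volume.restrict (Ioo (0 : ℝ) 1)).prod volume)) := by
  have hθm := hθ.measurable
  have h1 : Measurable fun q : EuclideanSpace ℝ (Fin n) × (ℝ × EuclideanSpace ℝ (Fin n)) =>
      (1 - q.2.1) ^ (n - ℓ) * (θ (q.2.2 + q.2.1⁻¹ • (q.1 - q.2.2)) *
        ((q.1 m - q.2.2 m) / q.2.1)) / q.2.1 ^ n := by fun_prop
  refine (h1.aestronglyMeasurable.mul hf.comp_snd.comp_snd).congr
    (Filter.Eventually.of_forall fun q => ?_)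
  simp only [bogIntegrand, Pi.mul_apply]
  ring

theorem ae_prod_Ioo_support (hfΩ : ∀ᵐ y ∂volume, y ∉ Ω → f y = 0) :
    ∀ᵐ p : ℝ × EuclideanSpace ℝ (Fin n) ∂((volume.restrict (Ioo (0 : ℝ) 1)).prod volume),
      p.1 ∈ Ioo (0 : ℝ) 1 ∧ (p.2 ∉ Ω → f p.2 = 0) :=
  (Measure.quasiMeasurePreserving_fst.ae (ae_restrict_mem measurableSet_Ioo)).and
    (Measure.quasiMeasurePreserving_snd.ae hfΩ)

theorem enorm_bogIntegrand_convex_comb_le (hR : ∀ z, θ z ≠ 0 → ∀ y ∈ Ω, |z m - y m| ≤ R)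
    {s : ℝ} (hs : s ∈ Ioo (0 : ℝ) 1) {y : EuclideanSpace ℝ (Fin n)} (hy : y ∉ Ω → f y = 0)
    (z : EuclideanSpace ℝ (Fin n)) :
    ENNReal.ofReal (s ^ n) * ‖bogIntegrand ℓ θ m f ((1 - s) • y + s • z) s y‖ₑ ≤
      ENNReal.ofReal R * ‖f y‖ₑ * ‖θ z‖ₑ := by
  have hs0 := hs.1
  rw [bogIntegrand_convex_comb hs0]
  by_cases hfy : f y = 0
  · simp [hfy]
  by_cases hθz : θ z = 0
  · simp [hθz]
  have hyΩ : y ∈ Ω := by by_contra h; exact hfy (hy h)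
  have hR0 : 0 ≤ R := (abs_nonneg _).trans (hR z hθz y hyΩ)
  simp only [← ofReal_norm]
  rw [← ENNReal.ofReal_mul (by positivity), ← ENNReal.ofReal_mul (by positivity),
    ← ENNReal.ofReal_mul (by positivity)]
  apply ENNReal.ofReal_le_ofReal
  have h1 : 0 ≤ 1 - s := by linarith [hs.2]
  have h2 : (1 - s) ^ (n - ℓ) ≤ 1 := pow_le_one₀ h1 (by linarith)
  rw [norm_div, norm_mul, norm_mul, norm_mul, norm_pow, norm_pow, Real.norm_of_nonneg h1,
    Real.norm_of_nonneg hs0.le, mul_div_cancel₀ _ (by positivity), Real.norm_eq_abs (z m - y m)]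
  calc _ ≤ 1 * (‖θ z‖ * R * ‖f y‖) := by
        gcongr
        exact hR z hθz y hyΩ
    _ = _ := by ring

theorem lintegral_bogIntegrand_le (hR : ∀ z, θ z ≠ 0 → ∀ y ∈ Ω, |z m - y m| ≤ R)
    {s : ℝ} (hs : s ∈ Ioo (0 : ℝ) 1) {y : EuclideanSpace ℝ (Fin n)} (hy : y ∉ Ω → f y = 0) :
    ∫⁻ x, ‖bogIntegrand ℓ θ m f x s y‖ₑ ≤
      ENNReal.ofReal R * (∫⁻ z, ‖θ z‖ₑ) * ‖f y‖ₑ := by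
  rw [lintegral_eq_lintegral_convex_comb _ y hs.1, ← lintegral_const_mul' _ _ (by simp)]
  refine (lintegral_mono fun z => enorm_bogIntegrand_convex_comb_le hR hs hy z).trans_eq ?_
  rw [lintegral_const_mul' _ _ (ENNReal.mul_ne_top (by simp) (by simp))]
  ring

/-- By Tonelli with `x` integrated first, the inner integral is at most `R ‖θ‖_1 |f(y)|` for every
`s`. -/
theorem integrable_bogIntegrand (hθ : Continuous θ) (hθi : Integrable θ) (hf : Integrable f)
    (hfΩ : ∀ᵐ y ∂volume, y ∉ Ω → f y = 0)
    (hR : ∀ z, θ z ≠ 0 → ∀ y ∈ Ω, |z m - y m| ≤ R) :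
    Integrable (fun q : EuclideanSpace ℝ (Fin n) × (ℝ × EuclideanSpace ℝ (Fin n)) =>
      bogIntegrand ℓ θ m f q.1 q.2.1 q.2.2)
      (volume.prod ((volume.restrict (Ioo (0 : ℝ) 1)).prod volume)) := by
  have hm := aestronglyMeasurable_bogIntegrand (ℓ := ℓ) (m := m) hθ hf.1
  refine ⟨hm, ?_⟩
  rw [hasFiniteIntegral_iff_enorm, lintegral_prod_symm _ hm.enorm]
  calc _ ≤ ∫⁻ p : ℝ × EuclideanSpace ℝ (Fin n), ENNReal.ofReal R * (∫⁻ z, ‖θ z‖ₑ) * ‖f p.2‖ₑ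
        ∂((volume.restrict (Ioo (0 : ℝ) 1)).prod volume) := by
        refine lintegral_mono_ae ?_
        filter_upwards [ae_prod_Ioo_support hfΩ] with p hp
        exact lintegral_bogIntegrand_le hR hp.1 hp.2
    _ = ENNReal.ofReal R * (∫⁻ z, ‖θ z‖ₑ) * ∫⁻ y, ‖f y‖ₑ := by
        have hfe := hf.1.enorm
        rw [lintegral_prod _ (hfe.const_mul _).comp_snd]
        simp only [lintegral_const, Measure.restrict_apply_univ, Real.volume_Ioo, sub_zero,
          ENNReal.ofReal_one, mul_one]
        exact lintegral_const_mul'' _ hfe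
    _ < ⊤ := ENNReal.mul_lt_top (ENNReal.mul_lt_top (by simp) hθi.2) hf.2

theorem bogReduced_ae_eq (hθ : Continuous θ) (hθi : Integrable θ) (hf : Integrable f)
    (hfΩ : ∀ᵐ y ∂volume, y ∉ Ω → f y = 0)
    (hR : ∀ z, θ z ≠ 0 → ∀ y ∈ Ω, |z m - y m| ≤ R) :
    bogReduced ℓ θ m f =ᵐ[volume] fun x => ∫ p : ℝ × EuclideanSpace ℝ (Fin n),
      bogIntegrand ℓ θ m f x p.1 p.2 ∂((volume.restrict (Ioo (0 : ℝ) 1)).prod volume) := by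
  filter_upwards [(integrable_bogIntegrand (ℓ := ℓ) hθ hθi hf hfΩ hR).prod_right_ae] with x hx
  exact (integral_prod _ hx).symm

/-- The kernel `|θ(y + (x - y) / s)| s⁻ⁿ`, restricted to `y ∈ Ω`. -/
noncomputable def bogKernel (θ : EuclideanSpace ℝ (Fin n) → ℝ)
    (Ω : Set (EuclideanSpace ℝ (Fin n))) (x : EuclideanSpace ℝ (Fin n))
    (p : ℝ × EuclideanSpace ℝ (Fin n)) : ℝ≥0∞ :=
  ENNReal.ofReal ((p.1 ^ n)⁻¹) *
    (Ω.indicator 1 p.2 * ‖θ (p.2 + p.1⁻¹ • (x - p.2))‖ₑ)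

theorem measurable_bogKernel (hθ : Continuous θ) (hΩ : MeasurableSet Ω) :
    Measurable fun q : EuclideanSpace ℝ (Fin n) × (ℝ × EuclideanSpace ℝ (Fin n)) =>
      bogKernel θ Ω q.1 q.2 := by
  have hθm := hθ.measurable
  have h1 : Measurable (Ω.indicator (1 : EuclideanSpace ℝ (Fin n) → ℝ≥0∞)) :=
    measurable_one.indicator hΩ
  unfold bogKernel
  fun_prop

theorem enorm_bogIntegrand_le_bogKernel (hR : ∀ z, θ z ≠ 0 → ∀ y ∈ Ω, |z m - y m| ≤ R)
    {s : ℝ} (hs : s ∈ Ioo (0 : ℝ) 1) {x y : EuclideanSpace ℝ (Fin n)} (hy : y ∉ Ω → f y = 0) :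
    ‖bogIntegrand ℓ θ m f x s y‖ₑ ≤
      ENNReal.ofReal R * (bogKernel θ Ω x (s, y) * 1 * ‖f y‖ₑ) := by
  have hs0 := hs.1
  by_cases hfy : f y = 0
  · simp [bogIntegrand, hfy]
  have hyΩ : y ∈ Ω := by by_contra h; exact hfy (hy h)
  set z := y + s⁻¹ • (x - y) with hz
  have hx : x = (1 - s) • y + s • z := by
    rw [hz, smul_add, smul_smul, mul_inv_cancel₀ hs0.ne']
    module
  have h := enorm_bogIntegrand_convex_comb_le (ℓ := ℓ) hR hs hy z
  rw [← hx] at h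
  have hsn : ENNReal.ofReal ((s ^ n)⁻¹) * ENNReal.ofReal (s ^ n) = 1 := by
    rw [← ENNReal.ofReal_mul (by positivity), inv_mul_cancel₀ (by positivity), ENNReal.ofReal_one]
  calc ‖bogIntegrand ℓ θ m f x s y‖ₑ
      = ENNReal.ofReal ((s ^ n)⁻¹) *
          (ENNReal.ofReal (s ^ n) * ‖bogIntegrand ℓ θ m f x s y‖ₑ) := by
        rw [← mul_assoc, hsn, one_mul]
    _ ≤ ENNReal.ofReal ((s ^ n)⁻¹) * (ENNReal.ofReal R * ‖f y‖ₑ * ‖θ z‖ₑ) := by gcongr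
    _ = _ := by
        simp only [bogKernel, indicator_of_mem hyΩ, Pi.one_apply]
        ring

theorem lintegral_bogKernel_left (θ : EuclideanSpace ℝ (Fin n) → ℝ) {s : ℝ} (hs : 0 < s)
    (y : EuclideanSpace ℝ (Fin n)) :
    ∫⁻ x, bogKernel θ Ω x (s, y) ≤ ∫⁻ z, ‖θ z‖ₑ := by
  rw [lintegral_eq_lintegral_convex_comb _ y hs, ← lintegral_const_mul' _ _ (by simp)]
  refine lintegral_mono fun z => ?_
  have h1 : y + s⁻¹ • ((1 - s) • y + s • z - y) = z := by
    have : (1 - s) • y + s • z - y = s • (z - y) := by module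
    rw [this, smul_smul, inv_mul_cancel₀ hs.ne', one_smul, add_sub_cancel]
  simp only [bogKernel, h1]
  rw [← mul_assoc, ← ENNReal.ofReal_mul (by positivity), mul_inv_cancel₀ (by positivity),
    ENNReal.ofReal_one, one_mul]
  refine mul_le_of_le_one_left' ?_
  exact indicator_le_self' (fun _ _ => zero_le_one) y

theorem lintegral_bogKernel_right_le (hΩ : MeasurableSet Ω) {B : ℝ} (hB : ∀ z, ‖θ z‖ ≤ B)
    {s : ℝ} (hs : s ∈ Ioo (0 : ℝ) 1) (x : EuclideanSpace ℝ (Fin n)) :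
    ∫⁻ y, bogKernel θ Ω x (s, y) ≤
      ENNReal.ofReal (2 ^ n) * ((∫⁻ z, ‖θ z‖ₑ) + volume Ω * ENNReal.ofReal B) := by
  have hs0 := hs.1
  have hs1 : 0 < 1 - s := by linarith [hs.2]
  simp only [bogKernel]
  rw [lintegral_const_mul' _ _ (by simp)]
  rcases le_total s (1 / 2) with h | h
  -- Here the Jacobian of `y ↦ ((1 - s)/s) y` cancels `s^(-n)` and leaves `(1 - s)^(-n) ≤ 2^n`. As
  -- `s → 1` this degenerates, so the other half uses `s^(-n) ≤ 2^n` and the sup bound for `θ` on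
  -- `Ω`.
  · have hc : 0 < (1 - s) / s := by positivity
    have e : ∀ y, y + s⁻¹ • (x - y) = s⁻¹ • x - ((1 - s) / s) • y := fun y => by
      have : (1 - s) / s = s⁻¹ - 1 := by field_simp
      rw [this]
      module
    calc _ ≤ ENNReal.ofReal ((s ^ n)⁻¹) *
          ∫⁻ y, (fun z => ‖θ (s⁻¹ • x - z)‖ₑ) (((1 - s) / s) • y) := by
          gcongr with y
          rw [e]
          refine mul_le_of_le_one_left' ?_
          exact indicator_le_self' (fun _ _ => zero_le_one) y
      _ = ENNReal.ofReal (((1 - s)⁻¹) ^ n) * ∫⁻ z, ‖θ z‖ₑ := by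
          rw [lintegral_comp_smul_eq (fun z => ‖θ (s⁻¹ • x - z)‖ₑ) hc, finrank_euclideanSpace_fin,
            lintegral_sub_left_eq_self (fun z => ‖θ z‖ₑ), ← mul_assoc,
            ← ENNReal.ofReal_mul (by positivity)]
          rw [← inv_pow, ← inv_pow, ← mul_pow]
          congr 3
          field_simp
      _ ≤ _ := by
          gcongr
          · rw [inv_le_comm₀ hs1 (by norm_num)]; linarith
          · exact le_self_add
  · gcongr
    · rw [← inv_pow]
      gcongr
      rw [inv_le_comm₀ hs0 (by norm_num)]; linarith
    · refine le_trans ?_ le_add_self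
      calc _ ≤ ∫⁻ y, Ω.indicator (fun _ => ENNReal.ofReal B) y := by
            refine lintegral_mono fun y => ?_
            by_cases hy : y ∈ Ω
            · simp only [indicator_of_mem hy, Pi.one_apply, one_mul, ← ofReal_norm]
              exact ENNReal.ofReal_le_ofReal (hB _)
            · simp [indicator_of_notMem hy]
        _ = _ := by rw [lintegral_indicator hΩ, setLIntegral_const, mul_comm]

/-- A Schur test for `bogKernel`: its integral over `(s, y)` is bounded uniformly in `x`, and its
integral over `x` uniformly in `(s, y)`. Only finiteness matters here, so the constants are not
sharp. -/
theorem memLp_bogReduced (hθ : Continuous θ) (hθi : Integrable θ) {B : ℝ}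
    (hB : ∀ z, ‖θ z‖ ≤ B) (hΩ : MeasurableSet Ω) (hΩfin : volume Ω ≠ ⊤) (hf : Integrable f)
    (hf2 : MemLp f 2 volume) (hfΩ : ∀ᵐ y ∂volume, y ∉ Ω → f y = 0)
    (hR : ∀ z, θ z ≠ 0 → ∀ y ∈ Ω, |z m - y m| ≤ R) :
    MemLp (bogReduced ℓ θ m f) 2 volume := by
  have hint := integrable_bogIntegrand (ℓ := ℓ) hθ hθi hf hfΩ hR
  refine (memLp_congr_ae (bogReduced_ae_eq hθ hθi hf hfΩ hR)).2
    ⟨hint.integral_prod_left.1, ?_⟩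
  set ν := (volume.restrict (Ioo (0 : ℝ) 1)).prod (volume : Measure (EuclideanSpace ℝ (Fin n)))
  have hk := measurable_bogKernel hθ hΩ
  have hfe : AEMeasurable (fun p : ℝ × EuclideanSpace ℝ (Fin n) => ‖f p.2‖ₑ) ν :=
    hf.1.enorm.comp_snd
  have hne : ∀ c : ℝ≥0∞, c ^ 2 < ⊤ → c < ⊤ := fun c hc => by
    by_contra h
    rw [not_lt_top_iff.1 h] at hc
    simp at hc
  set Ck := ENNReal.ofReal (2 ^ n) * ((∫⁻ z, ‖θ z‖ₑ) + volume Ω * ENNReal.ofReal B)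
  have hCk : Ck < ⊤ := by
    refine ENNReal.mul_lt_top (by simp) (ENNReal.add_lt_top.2 ⟨hθi.2, ?_⟩)
    exact ENNReal.mul_lt_top hΩfin.lt_top (by simp)
  have hk1 : ∀ x, ∫⁻ p, bogKernel θ Ω x p ∂ν ≤ Ck := by
    intro x
    rw [lintegral_prod _ (by exact (hk.comp measurable_prodMk_left).aemeasurable)]
    calc _ ≤ ∫⁻ s in Ioo (0 : ℝ) 1, Ck := setLIntegral_mono' measurableSet_Ioo fun s hs =>
          lintegral_bogKernel_right_le hΩ hB hs x
      _ = Ck := by simp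
  have hk2 : ∫⁻ x, ∫⁻ p, bogKernel θ Ω x p * ‖f p.2‖ₑ ^ 2 ∂ν < ⊤ := by
    rw [lintegral_lintegral_swap]
    · calc _ ≤ ∫⁻ p : ℝ × EuclideanSpace ℝ (Fin n), (∫⁻ z, ‖θ z‖ₑ) * ‖f p.2‖ₑ ^ 2 ∂ν := by
            refine lintegral_mono_ae ?_
            filter_upwards [ae_prod_Ioo_support hfΩ] with p hp
            rw [lintegral_mul_const' _ _ (by simp)]
            exact mul_le_mul_left (lintegral_bogKernel_left θ hp.1.1 p.2) _
        _ = (∫⁻ z, ‖θ z‖ₑ) * ∫⁻ y, ‖f y‖ₑ ^ 2 := by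
            rw [lintegral_prod _ (by fun_prop)]
            simp only [lintegral_const, Measure.restrict_apply_univ, Real.volume_Ioo, sub_zero,
              ENNReal.ofReal_one, mul_one]
            exact lintegral_const_mul'' _ (hf.1.enorm.pow_const 2)
        _ < ⊤ := by
            rw [← eLpNorm_two_sq]
            exact ENNReal.mul_lt_top hθi.2 (ENNReal.pow_lt_top hf2.2)
    · exact hk.aemeasurable.mul (hfe.comp_snd.pow_const 2)
  refine hne _ ?_
  rw [eLpNorm_two_sq]
  calc _ ≤ ∫⁻ x, ENNReal.ofReal R ^ 2 *
        (Ck * ∫⁻ p, bogKernel θ Ω x p * ‖f p.2‖ₑ ^ 2 ∂ν) := by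
        refine lintegral_mono fun x => ?_
        have hkx : Measurable fun p => bogKernel θ Ω x p := hk.comp measurable_prodMk_left
        calc _ ≤ (∫⁻ p, ENNReal.ofReal R * (bogKernel θ Ω x p * 1 * ‖f p.2‖ₑ) ∂ν) ^ 2 := by
              refine pow_le_pow_left' ((enorm_integral_le_lintegral_enorm _).trans ?_) 2
              refine lintegral_mono_ae ?_
              filter_upwards [ae_prod_Ioo_support hfΩ] with p hp
              exact enorm_bogIntegrand_le_bogKernel hR hp.1 hp.2
          _ = ENNReal.ofReal R ^ 2 * (∫⁻ p, bogKernel θ Ω x p * 1 * ‖f p.2‖ₑ ∂ν) ^ 2 := by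
              rw [lintegral_const_mul' _ _ (by simp), mul_pow]
          _ ≤ _ := by
              gcongr
              refine (lintegral_weight_mul_sq_le (f := fun _ => 1) hkx.aemeasurable
                aemeasurable_const hfe).trans ?_
              gcongr
              simpa using hk1 x
    _ = ENNReal.ofReal R ^ 2 *
        (Ck * ∫⁻ x, ∫⁻ p, bogKernel θ Ω x p * ‖f p.2‖ₑ ^ 2 ∂ν) := by
        rw [lintegral_const_mul' _ _ (by simp), lintegral_const_mul' _ _ hCk.ne]
    _ < ⊤ := ENNReal.mul_lt_top (by simp) (ENNReal.mul_lt_top hCk hk2)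

end Kernel

/-! ### The weak form of `Q_ℓ f` as a superposition of slice pairings -/

section WeakForm

variable {n ℓ : ℕ} {θ : EuclideanSpace ℝ (Fin n) → ℝ} {m : Fin n}
  {f ψ : EuclideanSpace ℝ (Fin n) → ℝ} {Ω : Set (EuclideanSpace ℝ (Fin n))} {R : ℝ}

/-- The bilinear form `∫ h(y) ∫ η(z) ψ((1 - s) y + s z) dz dy`. -/
noncomputable def slicePairing (η h ψ : EuclideanSpace ℝ (Fin n) → ℝ) (s : ℝ) : ℝ :=
  ∫ y, h y * ∫ z, η z * ψ ((1 - s) • y + s • z)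

theorem enorm_slicePairing_le {η h : EuclideanSpace ℝ (Fin n) → ℝ} (hη : Integrable η)
    (hh : Integrable h) (hψ : ContDiff ℝ ∞ ψ) (hc : HasCompactSupport ψ) (s : ℝ) :
    ‖slicePairing η h ψ s‖ₑ ≤
      fourierSlice (fun z => (η z : ℂ)) (fun y => (h y : ℂ)) (complexSchwartz ψ hψ hc) s := by
  have e : (slicePairing η h ψ s : ℂ) = ∫ y, (h y : ℂ) * ∫ z, (η z : ℂ) *
      complexSchwartz ψ hψ hc ((1 - s) • y + s • z) := by
    simp only [slicePairing, complexSchwartz_apply, ← Complex.ofReal_mul, integral_complex_ofReal]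
  have e2 : ‖slicePairing η h ψ s‖ₑ = ‖(slicePairing η h ψ s : ℂ)‖ₑ := by
    simp only [← ofReal_norm, Complex.norm_real]
  have hη' : Integrable fun z => (η z : ℂ) := hη.ofReal
  have hh' : Integrable fun y => (h y : ℂ) := hh.ofReal
  rw [e2, e, integral_integral_mul_schwartz_eq s (1 - s) hh' hη']
  refine (enorm_integral_le_lintegral_enorm _).trans_eq ?_
  simp only [enorm_mul, fourierSlice]

theorem integrable_mul_comp_convex_comb {η : EuclideanSpace ℝ (Fin n) → ℝ} (hη : Integrable η)
    (hψ : Continuous ψ) {B : ℝ} (hB : ∀ x, ‖ψ x‖ ≤ B) (s : ℝ) (y : EuclideanSpace ℝ (Fin n)) :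
    Integrable fun z => η z * ψ ((1 - s) • y + s • z) :=
  hη.mul_bdd (c := B) (Continuous.aestronglyMeasurable (by fun_prop))
    (Filter.Eventually.of_forall fun z => hB _)

theorem integrable_slicePairing {η h : EuclideanSpace ℝ (Fin n) → ℝ} (hη : Integrable η)
    (hh : Integrable h) (hψ : Continuous ψ) {B : ℝ} (hB : ∀ x, ‖ψ x‖ ≤ B) (s : ℝ) :
    Integrable fun y => h y * ∫ z, η z * ψ ((1 - s) • y + s • z) := by
  have h1 : Integrable (fun p : EuclideanSpace ℝ (Fin n) × EuclideanSpace ℝ (Fin n) =>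
      (h p.1 * η p.2) * ψ ((1 - s) • p.1 + s • p.2)) (volume.prod volume) :=
    (hh.mul_prod hη).mul_bdd (c := B) (Continuous.aestronglyMeasurable (by fun_prop))
      (Filter.Eventually.of_forall fun z => hB _)
  have h2 := h1.integral_prod_left
  simpa only [mul_assoc, integral_const_mul] using h2

/-- The point `c` is inserted in `z_m - y_m` so that each term is a function of `z` times a function
of `y`, as the Fourier identity requires. -/
theorem integral_bogIntegrand_mul (hθ : Continuous θ) (hc : HasCompactSupport θ)
    (hψ : Continuous ψ) {B : ℝ} (hB : ∀ x, ‖ψ x‖ ≤ B) (c : EuclideanSpace ℝ (Fin n))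
    {s : ℝ} (hs : 0 < s) (y : EuclideanSpace ℝ (Fin n)) :
    ∫ x, bogIntegrand ℓ θ m f x s y * ψ x = (1 - s) ^ (n - ℓ) *
      ((f y * ∫ z, ((z m - c m) * θ z) * ψ ((1 - s) • y + s • z)) -
        ((y m - c m) * f y) * ∫ z, θ z * ψ ((1 - s) • y + s • z)) := by
  have hθi : Integrable θ := hθ.integrable_of_hasCompactSupport hc
  have hηi : Integrable fun z : EuclideanSpace ℝ (Fin n) => (z m - c m) * θ z :=
    Continuous.integrable_of_hasCompactSupport (by fun_prop) hc.mul_left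
  rw [integral_eq_integral_convex_comb _ y hs, ← integral_const_mul, ← integral_const_mul,
    ← integral_const_mul, ← integral_sub
      ((integrable_mul_comp_convex_comb hηi hψ hB s y).const_mul _)
      ((integrable_mul_comp_convex_comb hθi hψ hB s y).const_mul _), ← integral_const_mul]
  congr 1 with z
  rw [bogIntegrand_convex_comb hs]
  field_simp
  ring

theorem integral_bogReduced_mul_eq (hθ : Continuous θ) (hc : HasCompactSupport θ)
    (hf : Integrable f) (hfΩ : ∀ᵐ y ∂volume, y ∉ Ω → f y = 0)
    (hR : ∀ z, θ z ≠ 0 → ∀ y ∈ Ω, |z m - y m| ≤ R) (c : EuclideanSpace ℝ (Fin n))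
    (hf2 : Integrable fun y => (y m - c m) * f y)
    (hψ : Continuous ψ) {B : ℝ} (hB : ∀ x, ‖ψ x‖ ≤ B) :
    ∫ x, bogReduced ℓ θ m f x * ψ x = ∫ s in Ioo (0 : ℝ) 1, (1 - s) ^ (n - ℓ) *
      (slicePairing (fun z => (z m - c m) * θ z) f ψ s -
        slicePairing θ (fun y => (y m - c m) * f y) ψ s) := by
  have hθi : Integrable θ := hθ.integrable_of_hasCompactSupport hc
  have hηi : Integrable fun z : EuclideanSpace ℝ (Fin n) => (z m - c m) * θ z :=
    Continuous.integrable_of_hasCompactSupport (by fun_prop) hc.mul_left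
  set ν := (volume.restrict (Ioo (0 : ℝ) 1)).prod (volume : Measure (EuclideanSpace ℝ (Fin n)))
  have hint := integrable_bogIntegrand (ℓ := ℓ) hθ hθi hf hfΩ hR
  have hint2 : Integrable (fun q : EuclideanSpace ℝ (Fin n) × (ℝ × EuclideanSpace ℝ (Fin n)) =>
      bogIntegrand ℓ θ m f q.1 q.2.1 q.2.2 * ψ q.1) (volume.prod ν) :=
    hint.mul_bdd (c := B) (Continuous.aestronglyMeasurable (by fun_prop))
      (Filter.Eventually.of_forall fun z => hB _)
  calc _ = ∫ x, ∫ p, bogIntegrand ℓ θ m f x p.1 p.2 * ψ x ∂ν := by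
        refine integral_congr_ae ?_
        filter_upwards [bogReduced_ae_eq (ℓ := ℓ) hθ hθi hf hfΩ hR] with x hx
        rw [hx, integral_mul_const]
    _ = ∫ p, (∫ x, bogIntegrand ℓ θ m f x p.1 p.2 * ψ x) ∂ν := integral_integral_swap hint2
    _ = ∫ s in Ioo (0 : ℝ) 1, ∫ y, ∫ x, bogIntegrand ℓ θ m f x s y * ψ x :=
        integral_prod _ hint2.integral_prod_right
    _ = _ := by
        refine setIntegral_congr_fun measurableSet_Ioo fun s hs => ?_
        simp only [integral_bogIntegrand_mul hθ hc hψ hB c hs.1]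
        rw [integral_const_mul, integral_sub (integrable_slicePairing hηi hf hψ hB s)
          (integrable_slicePairing hθi hf2 hψ hB s)]
        rfl

theorem enorm_integral_bogReduced_mul_le (hθ : Continuous θ) (hc : HasCompactSupport θ)
    (hf : Integrable f) (hfΩ : ∀ᵐ y ∂volume, y ∉ Ω → f y = 0)
    (hR : ∀ z, θ z ≠ 0 → ∀ y ∈ Ω, |z m - y m| ≤ R) (c : EuclideanSpace ℝ (Fin n))
    (hf2 : Integrable fun y => (y m - c m) * f y)
    (hψ : ContDiff ℝ ∞ ψ) (hψc : HasCompactSupport ψ) :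
    ‖∫ x, bogReduced ℓ θ m f x * ψ x‖ₑ ≤
      (∫⁻ s in Ioo (0 : ℝ) 1, ENNReal.ofReal ((1 - s) ^ (n - ℓ)) *
        fourierSlice (fun z => (((z m - c m) * θ z : ℝ) : ℂ)) (fun y => (f y : ℂ))
          (complexSchwartz ψ hψ hψc) s) +
      ∫⁻ s in Ioo (0 : ℝ) 1, ENNReal.ofReal ((1 - s) ^ (n - ℓ)) *
        fourierSlice (fun z => (θ z : ℂ)) (fun y => (((y m - c m) * f y : ℝ) : ℂ))
          (complexSchwartz ψ hψ hψc) s := by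
  have hθi : Integrable θ := hθ.integrable_of_hasCompactSupport hc
  have hηi : Integrable fun z : EuclideanSpace ℝ (Fin n) => (z m - c m) * θ z :=
    Continuous.integrable_of_hasCompactSupport (by fun_prop) hc.mul_left
  obtain ⟨B, hB⟩ := hψ.continuous.bounded_above_of_compact_support hψc
  have hmeas := measurable_fourierSlice (hηi.ofReal (𝕜 := ℂ)) (hf.ofReal (𝕜 := ℂ))
    (complexSchwartz ψ hψ hψc)
  rw [integral_bogReduced_mul_eq hθ hc hf hfΩ hR c hf2 hψ.continuous hB]
  refine (enorm_integral_le_lintegral_enorm _).trans ?_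
  rw [← lintegral_add_left]
  · refine setLIntegral_mono' measurableSet_Ioo fun s hs => ?_
    rw [enorm_mul, ← mul_add]
    refine mul_le_mul' (le_of_eq ?_) ?_
    · rw [← ofReal_norm, Real.norm_of_nonneg (pow_nonneg (by linarith [hs.2]) _)]
    · exact enorm_sub_le.trans (add_le_add (enorm_slicePairing_le hηi hf hψ hψc s)
        (enorm_slicePairing_le hθi hf2 hψ hψc s))
  · have : Measurable fun s : ℝ => ENNReal.ofReal ((1 - s) ^ (n - ℓ)) := by fun_prop
    exact this.mul hmeas

end WeakForm

/-! ### Star-shaped domains: null boundary, diameters and volumes -/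

section Geometry

variable {n : ℕ} {Ω : Set (EuclideanSpace ℝ (Fin n))} {c : EuclideanSpace ℝ (Fin n)} {r : ℝ}

namespace IsBoundedDomainStarShapedBall

/-- Replace `y` by a nearby `w ∈ Ω` and absorb the error into the centre: `μ y + (1 - μ) c = μ w +
(1 - μ) b`, where `b` stays in the ball once `w` is close enough. -/
theorem homothety_mem (h : IsBoundedDomainStarShapedBall Ω c r) {y : EuclideanSpace ℝ (Fin n)}
    (hy : y ∈ closure Ω) {μ : ℝ} (hμ : 0 < μ) (hμ1 : μ < 1) :
    AffineMap.homothety c μ y ∈ Ω := by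
  have hr := h.radius_pos
  have h1 : 0 < 1 - μ := by linarith
  obtain ⟨w, hw, hd⟩ := Metric.mem_closure_iff.1 hy (r * (1 - μ) / μ) (by positivity)
  set b := c + (μ / (1 - μ)) • (y - w) with hb
  have hbB : b ∈ Metric.ball c r := by
    rw [mem_ball_iff_norm, hb, add_sub_cancel_left, norm_smul, Real.norm_of_nonneg (by positivity),
      ← dist_eq_norm]
    calc _ < μ / (1 - μ) * (r * (1 - μ) / μ) := by gcongr
      _ = r := by field_simp
  refine h.convexHull_subset w hw ?_
  have hconv := convex_convexHull ℝ (Metric.ball c r ∪ {w})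
  have := hconv (subset_convexHull ℝ _ (Or.inr rfl : w ∈ Metric.ball c r ∪ {w}))
    (subset_convexHull ℝ _ (Or.inl hbB)) hμ.le h1.le (by ring)
  convert this using 1
  rw [AffineMap.homothety_apply, hb, smul_add, smul_smul, mul_div_cancel₀ _ h1.ne']
  simp only [vsub_eq_sub, vadd_eq_add]
  module

theorem volume_ne_top (h : IsBoundedDomainStarShapedBall Ω c r) : volume Ω ≠ ⊤ :=
  h.isBounded.measure_lt_top.ne

/-- The contraction of `closure Ω` by `μ < 1` about `c` lies in `Ω` and has volume `μ^n |closure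
Ω|`; let `μ → 1`. Hence the boundary is null, and support in the closure may be replaced by support
in `Ω`. -/
theorem volume_closure_le (h : IsBoundedDomainStarShapedBall Ω c r) :
    volume (closure Ω) ≤ volume Ω := by
  have key : ∀ μ : ℝ, 0 < μ → μ < 1 →
      ENNReal.ofReal (μ ^ n) * volume (closure Ω) ≤ volume Ω := by
    intro μ hμ hμ1
    have := Measure.addHaar_image_homothety volume c μ (closure Ω)
    rw [finrank_euclideanSpace_fin, abs_of_pos (by positivity)] at this
    rw [← this]
    refine measure_mono ?_
    rintro _ ⟨y, hy, rfl⟩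
    exact h.homothety_mem hy hμ hμ1
  have hfin : volume (closure Ω) ≠ ⊤ := h.isBounded.closure.measure_lt_top.ne
  have hlim : Filter.Tendsto (fun μ : ℝ => ENNReal.ofReal (μ ^ n) * volume (closure Ω))
      (nhdsWithin 1 (Iio 1)) (nhds (ENNReal.ofReal (1 ^ n) * volume (closure Ω))) := by
    refine ENNReal.Tendsto.mul_const ?_ (Or.inr hfin)
    exact ((ENNReal.continuous_ofReal.comp (continuous_pow n)).tendsto 1).mono_left
      nhdsWithin_le_nhds
  rw [one_pow, ENNReal.ofReal_one, one_mul] at hlim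
  refine le_of_tendsto hlim ?_
  filter_upwards [Ioo_mem_nhdsLT (zero_lt_one' ℝ)] with μ hμ
  exact key μ hμ.1 hμ.2

theorem ae_notMem_imp (h : IsBoundedDomainStarShapedBall Ω c r)
    {f : EuclideanSpace ℝ (Fin n) → ℝ} (hf : ∀ᵐ x ∂volume, x ∉ closure Ω → f x = 0) :
    ∀ᵐ x ∂volume, x ∉ Ω → f x = 0 := by
  have hnull : volume (closure Ω \ Ω) = 0 := by
    rw [measure_sdiff subset_closure h.isOpen.measurableSet.nullMeasurableSet h.volume_ne_top]
    exact tsub_eq_zero_of_le h.volume_closure_le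
  have : ∀ᵐ x ∂volume, x ∉ closure Ω \ Ω := measure_eq_zero_iff_ae_notMem.1 hnull
  filter_upwards [hf, this] with x hx1 hx2 hxΩ
  exact hx1 fun hxc => hx2 ⟨hxc, hxΩ⟩

theorem center_mem (h : IsBoundedDomainStarShapedBall Ω c r) : c ∈ Ω :=
  h.ball_subset (Metric.mem_ball_self h.radius_pos)

theorem norm_sub_center_le (h : IsBoundedDomainStarShapedBall Ω c r)
    {y : EuclideanSpace ℝ (Fin n)} (hy : y ∈ Ω) : ‖y - c‖ ≤ Metric.diam Ω := by
  rw [← dist_eq_norm]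
  exact Metric.dist_le_diam_of_mem h.isBounded hy h.center_mem

theorem abs_sub_center_le (h : IsBoundedDomainStarShapedBall Ω c r)
    {y : EuclideanSpace ℝ (Fin n)} (hy : y ∈ Ω) (m : Fin n) : |y m - c m| ≤ Metric.diam Ω := by
  refine le_trans ?_ (h.norm_sub_center_le hy)
  simpa using PiLp.norm_apply_le (y - c) m

theorem diam_ball_le (h : IsBoundedDomainStarShapedBall Ω c r) :
    Metric.diam (Metric.ball c r) ≤ Metric.diam Ω :=
  Metric.diam_mono h.ball_subset h.isBounded

theorem volume_real_ball_pos (h : IsBoundedDomainStarShapedBall Ω c r) :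
    0 < volume.real (Metric.ball c r) :=
  ENNReal.toReal_pos (Metric.measure_ball_pos _ _ h.radius_pos).ne' measure_ball_lt_top.ne

theorem one_le_volume_ratio (h : IsBoundedDomainStarShapedBall Ω c r) :
    1 ≤ volume.real Ω / volume.real (Metric.ball c r) := by
  rw [one_le_div h.volume_real_ball_pos]
  exact measureReal_mono h.ball_subset h.volume_ne_top

end IsBoundedDomainStarShapedBall

theorem volume_real_ball_eq (c : EuclideanSpace ℝ (Fin n)) {r : ℝ} (hr : 0 < r) :
    volume.real (Metric.ball c r) =
      (volume.real (Metric.ball (0 : EuclideanSpace ℝ (Fin n)) 1) / 2 ^ n) * (2 * r) ^ n := by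
  rw [measureReal_def, Measure.addHaar_ball_of_pos volume c hr, finrank_euclideanSpace_fin,
    ENNReal.toReal_mul, ENNReal.toReal_ofReal (by positivity), measureReal_def]
  rw [mul_pow]
  field_simp

theorem lintegral_enorm_sq_le_of_support {F : Type*} [NormedAddCommGroup F]
    {h : EuclideanSpace ℝ (Fin n) → F} (hh : AEStronglyMeasurable h volume)
    (hΩ : MeasurableSet Ω) (hs : ∀ᵐ x ∂volume, x ∉ Ω → h x = 0) :
    (∫⁻ x, ‖h x‖ₑ) ^ 2 ≤ volume Ω * eLpNorm h 2 volume ^ 2 := by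
  calc _ = (∫⁻ x, Ω.indicator 1 x * ‖h x‖ₑ) ^ 2 := by
        congr 1
        refine lintegral_congr_ae ?_
        filter_upwards [hs] with x hx
        by_cases hxΩ : x ∈ Ω
        · simp [indicator_of_mem hxΩ]
        · simp [hx hxΩ]
    _ ≤ _ := lintegral_mul_sq_le (measurable_one.indicator hΩ).aemeasurable hh.enorm
    _ = _ := by
        rw [eLpNorm_two_sq]
        congr 1
        have : ∀ x, (Ω.indicator (1 : EuclideanSpace ℝ (Fin n) → ℝ≥0∞) x) ^ 2 =
            Ω.indicator 1 x := fun x => by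
          by_cases hx : x ∈ Ω <;> simp [hx]
        simp only [this]
        exact lintegral_indicator_one hΩ

theorem integrable_of_support {h : EuclideanSpace ℝ (Fin n) → ℝ} (h2 : MemLp h 2 volume)
    (hΩ : MeasurableSet Ω) (hΩfin : volume Ω ≠ ⊤) (hs : ∀ᵐ x ∂volume, x ∉ Ω → h x = 0) :
    Integrable h := by
  refine ⟨h2.1, ?_⟩
  have := (lintegral_enorm_sq_le_of_support h2.1 hΩ hs).trans_lt
    (ENNReal.mul_lt_top hΩfin.lt_top (ENNReal.pow_lt_top h2.2))
  rw [hasFiniteIntegral_iff_enorm]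
  by_contra hcon
  rw [not_lt_top_iff.1 hcon] at this
  simp at this

end Geometry

/-! ### `θ` and `(z_m - c_m) θ` are bumps -/

section Bumps

variable {n : ℕ} {K : (Fin n → ℕ) → ℝ} {c : EuclideanSpace ℝ (Fin n)} {r : ℝ}
  {θ : EuclideanSpace ℝ (Fin n) → ℝ}

theorem foldr_partialDeriv_single (θ : EuclideanSpace ℝ (Fin n) → ℝ) (j : Fin n) (k : ℕ) :
    ∀ L : List (Fin n), L.Nodup →
      L.foldr (fun i v => (partialDeriv i)^[(Pi.single j k : Fin n → ℕ) i] v) θ =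
        if j ∈ L then (partialDeriv j)^[k] θ else θ
  | [], _ => by simp
  | i :: L, h => by
    rw [List.nodup_cons] at h
    rw [List.foldr_cons, foldr_partialDeriv_single θ j k L h.2]
    by_cases hij : i = j
    · subst hij
      simp [h.1]
    · simp [Ne.symm hij]

theorem multiDeriv_single (θ : EuclideanSpace ℝ (Fin n) → ℝ) (j : Fin n) (k : ℕ) :
    multiDeriv (Pi.single j k) θ = (partialDeriv j)^[k] θ := by
  rw [multiDeriv, foldr_partialDeriv_single θ j k _ (List.nodup_finRange n)]
  simp

theorem multiDeriv_zero (θ : EuclideanSpace ℝ (Fin n) → ℝ) : multiDeriv 0 θ = θ := by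
  simp [multiDeriv]

/-- The constant through which the family `K` enters the estimates. -/
def kernelConstant (K : (Fin n → ℕ) → ℝ) : ℝ :=
  1 + |K 0| + ∑ j, (2 * |K (Pi.single j 1)| + |K (Pi.single j 2)|)

theorem kernelConstant_pos (K : (Fin n → ℕ) → ℝ) : 0 < kernelConstant K := by
  unfold kernelConstant
  positivity

theorem le_kernelConstant (K : (Fin n → ℕ) → ℝ) (j : Fin n) :
    |K 0| + (2 * |K (Pi.single j 1)| + |K (Pi.single j 2)|) ≤ kernelConstant K := by
  unfold kernelConstant
  have := Finset.single_le_sum (f := fun j => 2 * |K (Pi.single j 1)| + |K (Pi.single j 2)|)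
    (fun i _ => by positivity) (Finset.mem_univ j)
  linarith

namespace IsRegularizingKernel

theorem hasCompactSupport (h : IsRegularizingKernel K c r θ) : HasCompactSupport θ :=
  HasCompactSupport.of_support_subset_isCompact (isCompact_closedBall c r)
    ((subset_tsupport θ).trans h.tsupport_subset)

theorem bounds (h : IsRegularizingKernel K c r θ) {ρ : ℝ}
    (hρ : Metric.diam (Metric.ball c r) = ρ) (hρ0 : 0 < ρ) :
    ((∫ x, |θ x| ≤ |K 0|) ∧ (∀ x, |θ x| ≤ |K 0| / ρ ^ n)) ∧
    (∀ j, (∫ x, |partialDeriv j θ x| ≤ |K (Pi.single j 1)| / ρ) ∧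
      (∀ x, |partialDeriv j θ x| ≤ |K (Pi.single j 1)| / ρ ^ (n + 1)) ∧
      ∫ x, |partialDeriv j (partialDeriv j θ) x| ≤ |K (Pi.single j 2)| / ρ ^ 2) := by
  have hi := h.integral_abs_le
  have ha := h.abs_le
  rw [hρ] at hi ha
  refine ⟨⟨?_, fun x => ?_⟩, fun j => ⟨?_, fun x => ?_, ?_⟩⟩
  · have := hi 0
    rw [multiDeriv_zero] at this
    refine this.trans ?_
    simpa using le_abs_self _
  · have := ha 0 x
    rw [multiDeriv_zero] at this
    refine this.trans ?_
    simp only [Pi.zero_apply, Finset.sum_const_zero, add_zero]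
    gcongr
    exact le_abs_self _
  · have := hi (Pi.single j 1)
    rw [multiDeriv_single] at this
    refine this.trans ?_
    simp only [Finset.sum_pi_single', Finset.mem_univ, if_true, pow_one]
    gcongr
    exact le_abs_self _
  · have := ha (Pi.single j 1) x
    rw [multiDeriv_single] at this
    refine this.trans ?_
    simp only [Finset.sum_pi_single', Finset.mem_univ, if_true]
    gcongr
    exact le_abs_self _
  · have := hi (Pi.single j 2)
    rw [multiDeriv_single] at this
    refine this.trans ?_
    simp only [Finset.sum_pi_single', Finset.mem_univ, if_true]
    gcongr
    exact le_abs_self _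

theorem isBump (h : IsRegularizingKernel K c r θ) {ρ : ℝ}
    (hρ : Metric.diam (Metric.ball c r) = ρ) (hρ0 : 0 < ρ) (hn : 0 < n) :
    IsBump (kernelConstant K) ρ θ := by
  obtain ⟨⟨h0, -⟩, hj⟩ := h.bounds hρ hρ0
  have hK := le_kernelConstant K
  have hK0 : |K 0| ≤ kernelConstant K := by
    have := hK ⟨0, hn⟩
    linarith [abs_nonneg (K (Pi.single ⟨0, hn⟩ 1)), abs_nonneg (K (Pi.single ⟨0, hn⟩ 2))]
  have hK1 : ∀ j, |K (Pi.single j 1)| ≤ kernelConstant K := fun j => by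
    linarith [hK j, abs_nonneg (K 0), abs_nonneg (K (Pi.single j 1)),
      abs_nonneg (K (Pi.single j 2))]
  have hK2 : ∀ j, |K (Pi.single j 2)| ≤ kernelConstant K := fun j => by
    linarith [hK j, abs_nonneg (K 0), abs_nonneg (K (Pi.single j 1)),
      abs_nonneg (K (Pi.single j 2))]
  refine ⟨h.contDiff, h.hasCompactSupport, h0.trans hK0, fun j => (hj j).1.trans ?_,
    fun j => (hj j).2.2.trans ?_, fun j x => ((hj j).2.1 x).trans ?_⟩
  · gcongr; exact hK1 j
  · gcongr; exact hK2 j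
  · gcongr; exact hK1 j

end IsRegularizingKernel

theorem partialDeriv_coord_mul {u : EuclideanSpace ℝ (Fin n) → ℝ} (hu : ContDiff ℝ ∞ u)
    (c : EuclideanSpace ℝ (Fin n)) (m j : Fin n) (x : EuclideanSpace ℝ (Fin n)) :
    partialDeriv j (fun z => (z m - c m) * u z) x =
      (if m = j then 1 else 0) * u x + (x m - c m) * partialDeriv j u x := by
  have h1 : HasFDerivAt (fun z : EuclideanSpace ℝ (Fin n) => z m - c m)
      (EuclideanSpace.proj m : EuclideanSpace ℝ (Fin n) →L[ℝ] ℝ) x :=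
    (EuclideanSpace.proj m : EuclideanSpace ℝ (Fin n) →L[ℝ] ℝ).hasFDerivAt.sub_const _
  have h2 : HasFDerivAt u (fderiv ℝ u x) x := ((hu.differentiable (by simp)) x).hasFDerivAt
  have h3 : HasFDerivAt (fun z : EuclideanSpace ℝ (Fin n) => (z m - c m) * u z) _ x := h1.mul h2
  rw [partialDeriv, h3.fderiv]
  simp [partialDeriv]
  ring

theorem partialDeriv_partialDeriv_coord_mul {u : EuclideanSpace ℝ (Fin n) → ℝ}
    (hu : ContDiff ℝ ∞ u) (c : EuclideanSpace ℝ (Fin n)) (m j : Fin n)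
    (x : EuclideanSpace ℝ (Fin n)) :
    partialDeriv j (partialDeriv j (fun z => (z m - c m) * u z)) x =
      2 * (if m = j then 1 else 0) * partialDeriv j u x +
        (x m - c m) * partialDeriv j (partialDeriv j u) x := by
  have hu' := contDiff_partialDeriv hu j
  have e : partialDeriv j (fun z => (z m - c m) * u z) =
      fun x => (if m = j then 1 else 0) * u x + (x m - c m) * partialDeriv j u x :=
    funext (partialDeriv_coord_mul hu c m j)
  have hsm : ContDiff ℝ ∞ fun z : EuclideanSpace ℝ (Fin n) =>
      (z m - c m) * partialDeriv j u z := by fun_prop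
  have h1 : HasFDerivAt (fun x => (if m = j then (1 : ℝ) else 0) * u x)
      ((if m = j then (1 : ℝ) else 0) • fderiv ℝ u x) x :=
    ((hu.differentiable (by simp)) x).hasFDerivAt.const_mul _
  have h2 := ((hsm.differentiable (by simp)) x).hasFDerivAt
  have h3 := partialDeriv_coord_mul hu' c m j x
  rw [e]
  unfold partialDeriv at h3 ⊢
  unfold partialDeriv at h2
  have h4 : HasFDerivAt (fun x : EuclideanSpace ℝ (Fin n) => (if m = j then (1 : ℝ) else 0) * u x +
    (x m - c m) * fderiv ℝ u x (EuclideanSpace.single j 1)) _ x := h1.add h2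
  rw [h4.fderiv]
  simp only [add_apply, smul_apply, smul_eq_mul]
  rw [h3]
  ring

/-- On the support of `θ` the coordinate factor is at most `r ≤ ρ`, and each derivative falling on
it removes one power of length. So the product rule gives the bounds for `θ` multiplied by `ρ`. The
cross term of `∂_j²` explains the `2` in `kernelConstant`. -/
theorem IsRegularizingKernel.isBump_coord_mul (h : IsRegularizingKernel K c r θ) {ρ : ℝ}
    (hρ : Metric.diam (Metric.ball c r) = ρ) (hρ0 : 0 < ρ) (hr : r ≤ ρ) (m : Fin n) :
    IsBump (kernelConstant K * ρ) ρ (fun z => (z m - c m) * θ z) := by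
  obtain ⟨⟨h0, h0'⟩, hj⟩ := h.bounds hρ hρ0
  have hK := le_kernelConstant K
  have hcoord : ∀ x ∈ tsupport θ, |x m - c m| ≤ ρ := by
    intro x hx
    have h1 := h.tsupport_subset hx
    rw [mem_closedBall_iff_norm] at h1
    refine le_trans ?_ (h1.trans hr)
    simpa using PiLp.norm_apply_le (x - c) m
  have hprod : ∀ u : EuclideanSpace ℝ (Fin n) → ℝ, tsupport u ⊆ tsupport θ → ∀ x,
      |(x m - c m) * u x| ≤ ρ * |u x| := by
    intro u hu x
    by_cases hx : x ∈ tsupport u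
    · rw [abs_mul]
      gcongr
      exact hcoord x (hu hx)
    · simp [image_eq_zero_of_notMem_tsupport hx]
  have hs1 : ∀ j, tsupport (partialDeriv j θ) ⊆ tsupport θ := tsupport_partialDeriv_subset θ
  have hs2 : ∀ j, tsupport (partialDeriv j (partialDeriv j θ)) ⊆ tsupport θ := fun j =>
    (tsupport_partialDeriv_subset _ j).trans (hs1 j)
  have hδ : ∀ j (a : ℝ), |(if m = j then (1 : ℝ) else 0) * a| ≤ |a| := fun j a => by
    split_ifs <;> simp
  have hc0 := h.hasCompactSupport
  have hd1 := fun j => contDiff_partialDeriv h.contDiff j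
  have hi0 : Integrable θ := h.contDiff.continuous.integrable_of_hasCompactSupport hc0
  have hi1 : ∀ j, Integrable (partialDeriv j θ) := fun j =>
    (hd1 j).continuous.integrable_of_hasCompactSupport (hasCompactSupport_partialDeriv hc0 j)
  have hi2 : ∀ j, Integrable (partialDeriv j (partialDeriv j θ)) := fun j =>
    (contDiff_partialDeriv (hd1 j) j).continuous.integrable_of_hasCompactSupport
      (hasCompactSupport_partialDeriv (hasCompactSupport_partialDeriv hc0 j) j)
  refine ⟨by have := h.contDiff; fun_prop, hc0.mul_left, ?_, fun j => ?_, fun j => ?_,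
    fun j x => ?_⟩
  · calc _ ≤ ∫ x, ρ * |θ x| := by
          refine integral_mono_of_nonneg (Filter.Eventually.of_forall fun x => abs_nonneg _)
            (hi0.abs.const_mul ρ) (Filter.Eventually.of_forall fun x => ?_)
          exact hprod θ subset_rfl x
      _ ≤ ρ * kernelConstant K := by
          rw [integral_const_mul]
          gcongr
          refine h0.trans ?_
          linarith [hK m, abs_nonneg (K (Pi.single m 1)), abs_nonneg (K (Pi.single m 2))]
      _ = _ := mul_comm _ _
  · calc _ ≤ ∫ x, (|θ x| + ρ * |partialDeriv j θ x|) := by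
          refine integral_mono_of_nonneg (Filter.Eventually.of_forall fun x => abs_nonneg _)
            (hi0.abs.add ((hi1 j).abs.const_mul ρ)) (Filter.Eventually.of_forall fun x => ?_)
          simp only
          rw [partialDeriv_coord_mul h.contDiff]
          exact (abs_add_le _ _).trans (add_le_add (hδ j _) (hprod _ (hs1 j) x))
      _ ≤ |K 0| + ρ * (|K (Pi.single j 1)| / ρ) := by
          rw [integral_add hi0.abs ((hi1 j).abs.const_mul ρ), integral_const_mul]
          gcongr
          exact (hj j).1
      _ = |K 0| + |K (Pi.single j 1)| := by field_simp
      _ ≤ kernelConstant K := by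
          linarith [hK j, abs_nonneg (K (Pi.single j 1)), abs_nonneg (K (Pi.single j 2))]
      _ = _ := by field_simp
  · calc _ ≤ ∫ x, (2 * |partialDeriv j θ x| + ρ * |partialDeriv j (partialDeriv j θ) x|) := by
          refine integral_mono_of_nonneg (Filter.Eventually.of_forall fun x => abs_nonneg _)
            (((hi1 j).abs.const_mul 2).add ((hi2 j).abs.const_mul ρ))
            (Filter.Eventually.of_forall fun x => ?_)
          simp only
          rw [partialDeriv_partialDeriv_coord_mul h.contDiff]
          refine (abs_add_le _ _).trans (add_le_add ?_ (hprod _ (hs2 j) x))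
          rw [mul_assoc, abs_mul, abs_two]
          exact mul_le_mul_of_nonneg_left (hδ j _) zero_le_two
      _ ≤ 2 * (|K (Pi.single j 1)| / ρ) + ρ * (|K (Pi.single j 2)| / ρ ^ 2) := by
          rw [integral_add ((hi1 j).abs.const_mul 2) ((hi2 j).abs.const_mul ρ),
            integral_const_mul, integral_const_mul]
          gcongr
          · exact (hj j).1
          · exact (hj j).2.2
      _ = (2 * |K (Pi.single j 1)| + |K (Pi.single j 2)|) / ρ := by field_simp
      _ ≤ kernelConstant K / ρ := by
          gcongr
          linarith [hK j, abs_nonneg (K 0)]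
      _ = _ := by field_simp
  · rw [partialDeriv_coord_mul h.contDiff]
    calc _ ≤ |θ x| + ρ * |partialDeriv j θ x| :=
          (abs_add_le _ _).trans (add_le_add (hδ j _) (hprod _ (hs1 j) x))
      _ ≤ |K 0| / ρ ^ n + ρ * (|K (Pi.single j 1)| / ρ ^ (n + 1)) := by
          gcongr
          · exact h0' x
          · exact (hj j).2.1 x
      _ = (|K 0| + |K (Pi.single j 1)|) / ρ ^ n := by
          rw [pow_succ]
          field_simp
      _ ≤ kernelConstant K / ρ ^ n := by
          gcongr
          linarith [hK j, abs_nonneg (K (Pi.single j 1)), abs_nonneg (K (Pi.single j 2))]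
      _ = _ := by
          rw [pow_succ]
          field_simp

end Bumps

/-! ### Weak derivatives from bounds on test functions -/

section Duality

/-- The bound makes `Λ` vanish on `ker ι`, so it descends to a bounded functional on the range of
`ι`. Hahn–Banach extends it with the same norm, and Riesz represents the extension. -/
theorem exists_inner_eq_of_abs_le {T H : Type*} [AddCommGroup T] [Module ℝ T]
    [NormedAddCommGroup H] [InnerProductSpace ℝ H] [CompleteSpace H] (ι : T →ₗ[ℝ] H)
    (Λ : T →ₗ[ℝ] ℝ) {M : ℝ} (hM : 0 ≤ M) (h : ∀ t, |Λ t| ≤ M * ‖ι t‖) :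
    ∃ g : H, ‖g‖ ≤ M ∧ ∀ t, Λ t = inner ℝ g (ι t) := by
  have hker : LinearMap.ker ι ≤ LinearMap.ker Λ := by
    intro t ht
    have := h t
    rw [LinearMap.mem_ker.1 ht, norm_zero, mul_zero] at this
    exact abs_nonpos_iff.1 this
  let Λ' : LinearMap.range ι →ₗ[ℝ] ℝ :=
    ((LinearMap.ker ι).liftQ Λ hker).comp ι.quotKerEquivRange.symm.toLinearMap
  have hΛ' : ∀ t, Λ' ⟨ι t, LinearMap.mem_range_self ι t⟩ = Λ t := by
    intro t
    have : ι.quotKerEquivRange.symm ⟨ι t, LinearMap.mem_range_self ι t⟩ =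
        (LinearMap.ker ι).mkQ t := by
      rw [LinearEquiv.symm_apply_eq]
      rfl
    simp [Λ', this]
  let Λc : StrongDual ℝ (LinearMap.range ι) := Λ'.mkContinuous M (by
    rintro ⟨_, t, rfl⟩
    rw [hΛ']
    exact h t)
  obtain ⟨G, hG, hGn⟩ := exists_extension_norm_eq (LinearMap.range ι) Λc
  refine ⟨(InnerProductSpace.toDual ℝ H).symm G, ?_, fun t => ?_⟩
  · rw [LinearIsometryEquiv.norm_map, hGn]
    exact LinearMap.mkContinuous_norm_le _ hM _
  · rw [InnerProductSpace.toDual_symm_apply, ← hΛ']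
    exact (hG ⟨ι t, LinearMap.mem_range_self ι t⟩).symm

theorem eLpNorm_two_eq_ofReal_sqrt {α : Type*} [MeasurableSpace α] {μ : Measure α} {f : α → ℝ}
    (hf : MemLp f 2 μ) : eLpNorm f 2 μ = ENNReal.ofReal (√(∫ x, f x ^ 2 ∂μ)) := by
  refine (ENNReal.pow_le_pow_left_iff two_ne_zero).1 (le_of_eq ?_) |>.antisymm
    ((ENNReal.pow_le_pow_left_iff two_ne_zero).1 (le_of_eq ?_)) <;>
  · rw [eLpNorm_two_sq, ← ENNReal.ofReal_pow (by positivity),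
      Real.sq_sqrt (integral_nonneg fun x => sq_nonneg _),
      ofReal_integral_eq_lintegral_ofReal hf.integrable_sq
        (Filter.Eventually.of_forall fun x => sq_nonneg _)]
    refine lintegral_congr fun x => ?_
    rw [← ofReal_norm, ← ENNReal.ofReal_pow (by positivity), Real.norm_eq_abs, sq_abs]

variable {n : ℕ} {Ω : Set (EuclideanSpace ℝ (Fin n))}

/-- The space of test functions `C_c^∞(Ω)`. -/
def testSpace (Ω : Set (EuclideanSpace ℝ (Fin n))) :
    Submodule ℝ (EuclideanSpace ℝ (Fin n) → ℝ) where
  carrier := {φ | ContDiff ℝ ∞ φ ∧ HasCompactSupport φ ∧ tsupport φ ⊆ Ω}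
  add_mem' := by
    rintro φ ψ ⟨h1, h2, h3⟩ ⟨h4, h5, h6⟩
    exact ⟨h1.add h4, h2.add h5, (tsupport_add φ ψ).trans (union_subset h3 h6)⟩
  zero_mem' := ⟨contDiff_const, HasCompactSupport.zero, by simp⟩
  smul_mem' := by
    rintro a φ ⟨h1, h2, h3⟩
    exact ⟨contDiff_const.smul h1, h2.smul_left (f := fun _ => a),
      (tsupport_smul_subset_right (fun _ => a) φ).trans h3⟩

theorem memLp_of_contDiff_of_hasCompactSupport {φ : EuclideanSpace ℝ (Fin n) → ℝ}
    (h1 : ContDiff ℝ ∞ φ) (h2 : HasCompactSupport φ) : MemLp φ 2 (volume.restrict Ω) :=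
  (h1.continuous.memLp_of_hasCompactSupport h2).restrict Ω

theorem exists_weak_partialDeriv {u : EuclideanSpace ℝ (Fin n) → ℝ}
    (hu : MemLp u 2 (volume.restrict Ω)) (j : Fin n) {M : ℝ} (hM : 0 ≤ M)
    (h : ∀ φ : EuclideanSpace ℝ (Fin n) → ℝ, ContDiff ℝ ∞ φ → HasCompactSupport φ →
      tsupport φ ⊆ Ω → |∫ x in Ω, u x * partialDeriv j φ x| ≤ M * √(∫ x in Ω, φ x ^ 2)) :
    ∃ g : EuclideanSpace ℝ (Fin n) → ℝ, MemLp g 2 (volume.restrict Ω) ∧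
      ∫ x in Ω, g x ^ 2 ≤ M ^ 2 ∧
      ∀ φ : EuclideanSpace ℝ (Fin n) → ℝ, ContDiff ℝ ∞ φ → HasCompactSupport φ →
        tsupport φ ⊆ Ω → ∫ x in Ω, u x * partialDeriv j φ x = - ∫ x in Ω, g x * φ x := by
  have hmem : ∀ φ : testSpace Ω, MemLp φ.1 2 (volume.restrict Ω) := fun φ =>
    memLp_of_contDiff_of_hasCompactSupport φ.2.1 φ.2.2.1
  have hdiff : ∀ φ : testSpace Ω, Differentiable ℝ φ.1 := fun φ =>
    φ.2.1.differentiable (by simp)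
  have hint : ∀ φ : testSpace Ω, Integrable (fun x => u x * partialDeriv j φ.1 x)
      (volume.restrict Ω) := fun φ =>
    hu.integrable_mul (memLp_of_contDiff_of_hasCompactSupport (contDiff_partialDeriv φ.2.1 j)
      (hasCompactSupport_partialDeriv φ.2.2.1 j))
  let ι : testSpace Ω →ₗ[ℝ] Lp ℝ 2 (volume.restrict Ω) :=
    { toFun := fun φ => (hmem φ).toLp φ.1
      map_add' := fun φ ψ => MemLp.toLp_add (hmem φ) (hmem ψ)
      map_smul' := fun a φ => MemLp.toLp_const_smul a (hmem φ) }
  let Λ : testSpace Ω →ₗ[ℝ] ℝ :=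
    { toFun := fun φ => ∫ x in Ω, u x * partialDeriv j φ.1 x
      map_add' := fun φ ψ => by
        rw [← integral_add (hint φ) (hint ψ)]
        congr 1 with x
        have e : partialDeriv j (φ + ψ : testSpace Ω).1 x =
            partialDeriv j φ.1 x + partialDeriv j ψ.1 x := by
          simp [partialDeriv, fderiv_add (hdiff φ x) (hdiff ψ x)]
        rw [e, mul_add]
      map_smul' := fun a φ => by
        rw [RingHom.id_apply, smul_eq_mul, ← integral_const_mul]
        congr 1 with x
        have e : partialDeriv j (a • φ : testSpace Ω).1 x = a * partialDeriv j φ.1 x := by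
          simp [partialDeriv, fderiv_const_smul (hdiff φ x)]
        rw [e]
        ring }
  obtain ⟨G, hG, hGΛ⟩ := exists_inner_eq_of_abs_le ι Λ hM (fun φ => by
    refine (h φ.1 φ.2.1 φ.2.2.1 φ.2.2.2).trans_eq ?_
    congr 1
    change _ = ‖(hmem φ).toLp φ.1‖
    rw [Lp.norm_toLp, eLpNorm_two_eq_ofReal_sqrt (hmem φ), ENNReal.toReal_ofReal (by positivity)])
  have hGmem := Lp.memLp G
  -- The minus sign is that of integration by parts.
  refine ⟨fun x => -G x, hGmem.neg, ?_, fun φ h1 h2 h3 => ?_⟩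
  · have e : √(∫ x in Ω, G x ^ 2) = ‖G‖ := by
      rw [Lp.norm_def, eLpNorm_two_eq_ofReal_sqrt hGmem, ENNReal.toReal_ofReal (by positivity)]
    rw [← e] at hG
    simp only [neg_sq]
    exact (Real.sqrt_le_left hM).1 hG
  · have := hGΛ ⟨φ, h1, h2, h3⟩
    rw [L2.inner_def] at this
    refine this.trans ?_
    simp only [neg_mul]
    rw [integral_neg, neg_neg]
    refine integral_congr_ae ?_
    filter_upwards [(hmem ⟨φ, h1, h2, h3⟩).coeFn_toLp] with x hx
    change inner ℝ (G x) ((hmem ⟨φ, h1, h2, h3⟩).toLp φ x) = _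
    rw [hx]
    simp [mul_comm]

end Duality

/-! ### Assembly of the gradient estimate -/

section Main

variable {n ℓ : ℕ} {K : (Fin n → ℕ) → ℝ} {Ω : Set (EuclideanSpace ℝ (Fin n))}
  {c : EuclideanSpace ℝ (Fin n)} {r : ℝ} {θ f φ : EuclideanSpace ℝ (Fin n) → ℝ} {m : Fin n}

theorem eLpNorm_eq_restrict_of_support (hΩ : MeasurableSet Ω)
    (hs : ∀ᵐ x ∂volume, x ∉ Ω → f x = 0) :
    eLpNorm f 2 volume = eLpNorm f 2 (volume.restrict Ω) := by
  rw [← eLpNorm_indicator_eq_eLpNorm_restrict hΩ]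
  refine eLpNorm_congr_ae ?_
  filter_upwards [hs] with x hx
  by_cases h : x ∈ Ω
  · rw [indicator_of_mem h]
  · rw [indicator_of_notMem h, hx h]

theorem eLpNorm_ofReal_eq (f : EuclideanSpace ℝ (Fin n) → ℝ) :
    eLpNorm (fun x => (f x : ℂ)) 2 volume = eLpNorm f 2 volume :=
  eLpNorm_congr_norm_ae (Filter.Eventually.of_forall fun x => by simp)

theorem lintegral_enorm_sq_le_volume_ratio (h : IsBoundedDomainStarShapedBall Ω c r)
    (hf : AEStronglyMeasurable f volume) (hs : ∀ᵐ x ∂volume, x ∉ Ω → f x = 0) :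
    (∫⁻ x, ‖(f x : ℂ)‖ₑ) ^ 2 ≤
      ENNReal.ofReal (volume.real Ω / volume.real (Metric.ball c r) *
        (volume.real (Metric.ball (0 : EuclideanSpace ℝ (Fin n)) 1) / 2 ^ n * (2 * r) ^ n)) *
          eLpNorm (fun x => (f x : ℂ)) 2 volume ^ 2 := by
  rw [← volume_real_ball_eq c h.radius_pos, div_mul_cancel₀ _ h.volume_real_ball_pos.ne',
    measureReal_def, ENNReal.ofReal_toReal h.volume_ne_top]
  refine lintegral_enorm_sq_le_of_support (Complex.continuous_ofReal.comp_aestronglyMeasurable hf)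
    h.isOpen.measurableSet ?_
  filter_upwards [hs] with x hx hxΩ
  simp [hx hxΩ]

theorem abs_coord_sub_le (hΩ : IsBoundedDomainStarShapedBall Ω c r)
    (hθ : IsRegularizingKernel K c r θ) (m : Fin n) (z : EuclideanSpace ℝ (Fin n)) (hz : θ z ≠ 0)
    (y : EuclideanSpace ℝ (Fin n)) (hy : y ∈ Ω) : |z m - y m| ≤ r + Metric.diam Ω := by
  have h1 : z ∈ Metric.closedBall c r := hθ.tsupport_subset (subset_tsupport θ hz)
  rw [mem_closedBall_iff_norm] at h1
  have h2 : |z m - c m| ≤ r := by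
    refine le_trans ?_ h1
    simpa using PiLp.norm_apply_le (z - c) m
  have h3 := hΩ.abs_sub_center_le hy m
  have h4 := abs_sub_le (z m) (c m) (y m)
  rw [abs_sub_comm (c m)] at h4
  linarith

theorem exists_abs_integral_bogReduced_le (n ℓ : ℕ) (hℓ : 1 ≤ ℓ) (hℓn : ℓ ≤ n)
    (K : (Fin n → ℕ) → ℝ) : ∃ C : ℝ, 0 < C ∧
    ∀ (Ω : Set (EuclideanSpace ℝ (Fin n))) (c : EuclideanSpace ℝ (Fin n)) (r : ℝ),
      IsBoundedDomainStarShapedBall Ω c r →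
    ∀ θ : EuclideanSpace ℝ (Fin n) → ℝ, IsRegularizingKernel K c r θ →
    ∀ (m j : Fin n) (f : EuclideanSpace ℝ (Fin n) → ℝ),
      MemLp f 2 volume → (∀ᵐ x ∂volume, x ∉ Ω → f x = 0) →
    ∀ φ : EuclideanSpace ℝ (Fin n) → ℝ, ContDiff ℝ ∞ φ → HasCompactSupport φ → tsupport φ ⊆ Ω →
      |∫ x in Ω, bogReduced ℓ θ m f x * partialDeriv j φ x| ≤
        C * (Metric.diam Ω / Metric.diam (Metric.ball c r)) *
          bogKappa n ℓ (volume.real Ω / volume.real (Metric.ball c r)) *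
          √(∫ x in Ω, f x ^ 2) * √(∫ x in Ω, φ x ^ 2) := by
  have hn : 0 < n := by omega
  have : Nonempty (Fin n) := ⟨⟨0, hn⟩⟩
  obtain ⟨C, hC, hmain⟩ := exists_lintegral_fourierSlice_le n ℓ hℓ hℓn
    (b := volume.real (Metric.ball (0 : EuclideanSpace ℝ (Fin n)) 1) / 2 ^ n) (by positivity)
  have hk := kernelConstant_pos K
  refine ⟨2 * C * kernelConstant K, by positivity, ?_⟩
  intro Ω c r hΩ θ hθ m j f hf2 hfΩ φ hφ hφc hφΩ
  have hr := hΩ.radius_pos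
  have hdiam : Metric.diam (Metric.ball c r) = 2 * r := Metric.diam_ball_eq c hr.le
  have hρR : 2 * r ≤ Metric.diam Ω := hdiam ▸ hΩ.diam_ball_le
  have hρ : 0 < 2 * r := by linarith
  set ρ := 2 * r with hρdef
  set R := Metric.diam Ω with hRdef
  set t := volume.real Ω / volume.real (Metric.ball c r) with htdef
  have hR0 : 0 < R := by linarith
  have ht : 1 ≤ t := hΩ.one_le_volume_ratio
  have hκ := one_le_bogKappa n ℓ ht
  have hΩm := hΩ.isOpen.measurableSet
  have hf := integrable_of_support hf2 hΩm hΩ.volume_ne_top hfΩ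
  set h := fun y : EuclideanSpace ℝ (Fin n) => (y m - c m) * f y with hhdef
  have hhm : AEStronglyMeasurable h volume :=
    (Continuous.aestronglyMeasurable (by fun_prop)).mul hf2.1
  have hhle : ∀ᵐ y ∂volume, ‖h y‖ ≤ R * ‖f y‖ := by
    filter_upwards [hfΩ] with y hy
    by_cases hyΩ : y ∈ Ω
    · rw [hhdef, norm_mul]
      gcongr
      exact hΩ.abs_sub_center_le hyΩ m
    · simp [hhdef, hy hyΩ]
  have hhE : eLpNorm h 2 volume ≤ ENNReal.ofReal R * eLpNorm f 2 volume :=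
    eLpNorm_le_mul_eLpNorm_of_ae_le_mul hhle 2
  have hh2 : MemLp h 2 volume := ⟨hhm, hhE.trans_lt (ENNReal.mul_lt_top (by simp) hf2.2)⟩
  have hhΩ : ∀ᵐ y ∂volume, y ∉ Ω → h y = 0 := by
    filter_upwards [hfΩ] with y hy hyΩ
    simp [hhdef, hy hyΩ]
  have hh := integrable_of_support hh2 hΩm hΩ.volume_ne_top hhΩ
  -- The masses differ by a factor `ρ`: after division by `ρ`, the first pairing is of order `‖f‖`,
  -- the second of order `‖h‖/ρ ≤ (R/ρ) ‖f‖`.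
  have hb1 := hθ.isBump_coord_mul hdiam hρ (by linarith) m
  have hb2 := hθ.isBump hdiam hρ hn
  have hψ := contDiff_partialDeriv hφ j
  have hψc := hasCompactSupport_partialDeriv hφc j
  have key := enorm_integral_bogReduced_mul_le (ℓ := ℓ) hθ.contDiff.continuous
    hθ.hasCompactSupport hf hfΩ (abs_coord_sub_le hΩ hθ m) c hh hψ hψc
  rw [← lineDeriv_complexSchwartz φ hφ hφc j] at key
  have I1 := hmain _ ρ t _ hb1 (fun y => (f y : ℂ)) (complexSchwartz φ hφ hφc) j hρ ht hf.ofReal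
    hf2.ofReal (lintegral_enorm_sq_le_volume_ratio hΩ hf2.1 hfΩ)
  have I2 := hmain _ ρ t _ hb2 (fun y => (h y : ℂ)) (complexSchwartz φ hφ hφc) j hρ ht hh.ofReal
    hh2.ofReal (lintegral_enorm_sq_le_volume_ratio hΩ hhm hhΩ)
  rw [eLpNorm_ofReal_eq] at I1 I2
  have hφE : eLpNorm (complexSchwartz φ hφ hφc) 2 volume =
      ENNReal.ofReal (√(∫ x in Ω, φ x ^ 2)) := by
    rw [← eLpNorm_two_eq_ofReal_sqrt (memLp_of_contDiff_of_hasCompactSupport hφ hφc),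
      ← eLpNorm_eq_restrict_of_support hΩm]
    · exact eLpNorm_ofReal_eq φ
    · exact Filter.Eventually.of_forall fun x hx =>
        image_eq_zero_of_notMem_tsupport fun h => hx (hφΩ h)
  have hfE : eLpNorm f 2 volume = ENNReal.ofReal (√(∫ x in Ω, f x ^ 2)) := by
    rw [eLpNorm_eq_restrict_of_support hΩm hfΩ, eLpNorm_two_eq_ofReal_sqrt (hf2.restrict Ω)]
  rw [hfE] at hhE
  rw [hφE, hfE] at I1
  rw [hφE] at I2
  set F := √(∫ x in Ω, f x ^ 2)
  set P := √(∫ x in Ω, φ x ^ 2)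
  have hF : 0 ≤ F := Real.sqrt_nonneg _
  have hP : 0 ≤ P := Real.sqrt_nonneg _
  have hres : ∫ x in Ω, bogReduced ℓ θ m f x * partialDeriv j φ x =
      ∫ x, bogReduced ℓ θ m f x * partialDeriv j φ x := by
    refine setIntegral_eq_integral_of_forall_compl_eq_zero fun x hx => ?_
    rw [image_eq_zero_of_notMem_tsupport (f := partialDeriv j φ)
      fun h => hx (hφΩ (tsupport_partialDeriv_subset φ j h)), mul_zero]
  rw [hres, hdiam]
  have hkρ : 1 ≤ R / ρ := (one_le_div hρ).2 hρR
  set κ := bogKappa n ℓ t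
  have J1 : ENNReal.ofReal (C * (kernelConstant K * ρ / ρ) * κ) *
      (ENNReal.ofReal F * ENNReal.ofReal P) ≤
        ENNReal.ofReal (C * kernelConstant K * (R / ρ) * κ * F * P) := by
    rw [← ENNReal.ofReal_mul hF, ← ENNReal.ofReal_mul (by positivity)]
    apply ENNReal.ofReal_le_ofReal
    rw [mul_div_cancel_right₀ _ hρ.ne']
    calc _ = C * kernelConstant K * κ * F * P * 1 := by ring
      _ ≤ C * kernelConstant K * κ * F * P * (R / ρ) := by gcongr
      _ = _ := by ring
  have J2 : ENNReal.ofReal (C * (kernelConstant K / ρ) * κ) *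
      (eLpNorm h 2 volume * ENNReal.ofReal P) ≤
        ENNReal.ofReal (C * kernelConstant K * (R / ρ) * κ * F * P) := by
    calc _ ≤ ENNReal.ofReal (C * (kernelConstant K / ρ) * κ) *
          (ENNReal.ofReal R * ENNReal.ofReal F * ENNReal.ofReal P) := by gcongr
      _ = _ := by
          rw [← ENNReal.ofReal_mul hR0.le, ← ENNReal.ofReal_mul (by positivity),
            ← ENNReal.ofReal_mul (by positivity)]
          congr 1
          ring
  have total := key.trans (add_le_add (I1.trans J1) (I2.trans J2))
  rw [← ENNReal.ofReal_add (by positivity) (by positivity), ← ofReal_norm,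
    ENNReal.ofReal_le_ofReal_iff (by positivity), Real.norm_eq_abs] at total
  exact total.trans_eq (by ring)

end Main

theorem mainTheorem8 (n ℓ : ℕ) (hℓ : 1 ≤ ℓ) (hℓn : ℓ ≤ n) (K : (Fin n → ℕ) → ℝ) :
    ∃ C : ℝ, 0 < C ∧
      ∀ (Ω : Set (EuclideanSpace ℝ (Fin n))) (c : EuclideanSpace ℝ (Fin n)) (r : ℝ),
        IsBoundedDomainStarShapedBall Ω c r →
      ∀ θ : EuclideanSpace ℝ (Fin n) → ℝ, IsRegularizingKernel K c r θ →
      ∀ (m : Fin n) (f : EuclideanSpace ℝ (Fin n) → ℝ),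
        MemLp f 2 volume → (∀ᵐ x ∂volume, x ∉ closure Ω → f x = 0) →
        (∀ᵐ x ∂volume.restrict Ω, Integrable
          (fun p : ℝ × EuclideanSpace ℝ (Fin n) => bogIntegrand ℓ θ m f x p.1 p.2)
          ((volume.restrict (Ioo (0 : ℝ) 1)).prod volume)) ∧
        ∃ g : Fin n → EuclideanSpace ℝ (Fin n) → ℝ,
          HasL2WeakGradient Ω (bogReduced ℓ θ m f) g ∧
          Real.sqrt (∑ j, ∫ x in Ω, g j x ^ 2) ≤
            C * (Metric.diam Ω / Metric.diam (Metric.ball c r)) *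
              bogKappa n ℓ (volume.real Ω / volume.real (Metric.ball c r)) *
              Real.sqrt (∫ x in Ω, f x ^ 2) := by
  have hn : (0 : ℝ) < n := by exact_mod_cast (by omega : 0 < n)
  obtain ⟨C, hC, hmain⟩ := exists_abs_integral_bogReduced_le n ℓ hℓ hℓn K
  -- Each of the `n` components of the gradient has norm at most `M`, whence `√n`.
  refine ⟨√n * C, by positivity, ?_⟩
  intro Ω c r hΩ θ hθ m f hf2 hfcl
  have hfΩ := hΩ.ae_notMem_imp hfcl
  have hΩm := hΩ.isOpen.measurableSet
  have hf := integrable_of_support hf2 hΩm hΩ.volume_ne_top hfΩ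
  have hθc := hθ.contDiff.continuous
  have hθi : Integrable θ := hθc.integrable_of_hasCompactSupport hθ.hasCompactSupport
  obtain ⟨B, hB⟩ := hθc.bounded_above_of_compact_support hθ.hasCompactSupport
  have hR := abs_coord_sub_le hΩ hθ m
  have hκ := one_le_bogKappa n ℓ hΩ.one_le_volume_ratio
  refine ⟨ae_restrict_of_ae
    (integrable_bogIntegrand (ℓ := ℓ) hθc hθi hf hfΩ hR).prod_right_ae, ?_⟩
  have hu : MemLp (bogReduced ℓ θ m f) 2 (volume.restrict Ω) :=
    (memLp_bogReduced hθc hθi hB hΩm hΩ.volume_ne_top hf hf2 hfΩ hR).restrict Ω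
  set M := C * (Metric.diam Ω / Metric.diam (Metric.ball c r)) *
    bogKappa n ℓ (volume.real Ω / volume.real (Metric.ball c r)) * √(∫ x in Ω, f x ^ 2)
  have hM : 0 ≤ M := by
    have h1 : 0 ≤ Metric.diam Ω := Metric.diam_nonneg
    have h2 : 0 ≤ Metric.diam (Metric.ball c r) := Metric.diam_nonneg
    positivity
  choose g hg hgM hgφ using fun j => exists_weak_partialDeriv hu j hM
    (hmain Ω c r hΩ θ hθ m j f hf2 hfΩ)
  refine ⟨g, ⟨hu, hg, hgφ⟩, ?_⟩
  calc √(∑ j, ∫ x in Ω, g j x ^ 2) ≤ √(∑ _j : Fin n, M ^ 2) := by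
        gcongr with j
        exact hgM j
    _ = √n * M := by
        rw [Finset.sum_const, Finset.card_univ, Fintype.card_fin, nsmul_eq_mul,
          Real.sqrt_mul hn.le, Real.sqrt_sq hM]
    _ = _ := by ring
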